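/- There is a universal constant $c>0$ such that the following holds. Let $d\ge 1$ be an integer, $L>0$, $1\le p\le\infty$, and write $\mathbb T^d_L=[0,2\pi L]^d$ with Lebesgue measure. Let $f\in L^p(\mathbb T^d_L)$ be complex-valued, with Fourier coefficients $$\widehat f\Big(\tfrac{k}{L}\Big)=\frac1{(2\pi L)^d}\int_{\mathbb T^d_L} f(x)\,e^{-\frac{i}{L}x\cdot k}\,dx,\qquad k\in\mathbb Z^d,$$ and suppose that $\{k/L : k\in\mathbb Z^d,\ \widehat f(k/L)\ne 0\}\subset J$ for some closed axis-parallel parallelepiped $J\subset\mathbb R^d$ with side lengths $b=(b_1,\dots,b_d)$, $b_j\ge 0$, located anywhere in $\mathbb R^d$. Let $\gamma\in(0,1]$ and $a=(a_1,\dots,a_d)$ with $0<a_j\le 2\pi L$ for all $j$, and let $S\subset\mathbb R^d$ be $(\gamma,a)$-thick, i.e. $S$ is Lebesgue measurable and $|S\cap P|\ge\gamma|P|$ for every axis-parallel parallelepiped $P=\prod_{j=1}^d[x_j-a_j/2,x_j+a_j/2]$, $x\in\mathbb R^d$. Then $$\|f\|_{L^p(\mathbb T^d_L)}\le\Big(\frac{c^d}{\gamma}\Big)^{c\,a\cdot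 b+\frac{6d+1}{p}}\|f\|_{L^p(S\cap\mathbb T^d_L)},$$ where $a\cdot b=\sum_{j=1}^d a_jb_j$ and $\frac{6d+1}{p}=0$ for $p=\infty$. The constant $c$ does not depend on $d$, $L$, $p$, $f$, $J$, $b$, $\gamma$, $a$ or $S$. -/

import Mathlib

open MeasureTheory
open scoped ENNReal

/-- The torus `[0, 2πL]^d`, as a cube in `ℝ^d` (with Lebesgue measure). -/
def torusBox (d : ℕ) (L : ℝ) : Set (Fin d → ℝ) :=
  {x | ∀ j, 0 ≤ x j ∧ x j ≤ 2 * Real.pi * L}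

/-- The Fourier coefficient at the frequency `k / L ∈ (ℤ / L)^d`:
`(2πL)^{-d} ∫_{[0,2πL]^d} f(x) exp(-i x·k / L) dx`. -/
noncomputable def torusFourierCoeff {d : ℕ} (L : ℝ) (f : (Fin d → ℝ) → ℂ) (k : Fin d → ℤ) : ℂ :=
  (((2 * Real.pi * L) ^ d : ℝ) : ℂ)⁻¹ *
    ∫ x in torusBox d L, f x * Complex.exp (-Complex.I * (((1 / L) * ∑ j, x j * (k j : ℝ) : ℝ) : ℂ))

/-- The support of the Fourier transform, as a subset of `(ℤ / L)^d ⊆ ℝ^d`. -/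
def torusFourierSupport {d : ℕ} (L : ℝ) (f : (Fin d → ℝ) → ℂ) : Set (Fin d → ℝ) :=
  {ξ | ∃ k : Fin d → ℤ, (∀ j, ξ j = (k j : ℝ) / L) ∧ torusFourierCoeff L f k ≠ 0}

/-- The axis-parallel closed parallelepiped with centre `x` and side lengths `s`. -/
def centredBox {d : ℕ} (x s : Fin d → ℝ) : Set (Fin d → ℝ) :=
  {y | ∀ j, x j - s j / 2 ≤ y j ∧ y j ≤ x j + s j / 2}

/-- `S ⊆ ℝ^d` is Lebesgue measurable, `γ ∈ (0,1]`, all `a j > 0`, and `|S ∩ P| ≥ γ |P|` for every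
axis-parallel parallelepiped `P` with side lengths `a`. -/
structure IsThickSet {d : ℕ} (γ : ℝ) (a : Fin d → ℝ) (S : Set (Fin d → ℝ)) : Prop where
  measurable : NullMeasurableSet S volume
  gamma_pos : 0 < γ
  gamma_le_one : γ ≤ 1
  side_pos : ∀ j, 0 < a j
  density : ∀ x : Fin d → ℝ,
    ENNReal.ofReal γ * volume (centredBox x a) ≤ volume (S ∩ centredBox x a)

/-! A bounded spectrum contains only finitely many points of the frequency lattice, so f is almost
everywhere a trigonometric polynomial (`ae_eq_expSum_of_torusFourierCoeff`). Multiplying by a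
character centres the spectral box at the origin without changing |f|. The rest is a good/bad box
argument of Logvinenko-Sereda type, driven by a pointwise form of Bernstein's inequality.

On a bounded interval the symbol ξ_j equals an absolutely convergent Fourier series, so a derivative
of the sum is a superposition of translates of the sum itself. Hence N-th directional derivatives
along vectors bounded by l are dominated at every point by the N-th iterate of one positive
averaging operator of total weight at most l·b (`enorm_expSum_mul_dot_pow_mul_dot_pow_le`). By
Jensen and periodicity its iterates have p-th moments over a period cell growing at most like
(l·b)^(Np) (`CoordPeriodic.iterate_avgOp`).

The period cell is cut into boxes with sides l_j between a_j and 2a_j. A box is good if at one of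
its points all iterates are bounded by 4(4A)^N times the L^p mean μ of the sum over the box, where A
= 2a·b. A Chebyshev argument summed over N shows that bad boxes carry at most half of the mass
(`setLIntegral_le_two_mul_sum_good`).

On a good box Q, Taylor expansion at the distinguished point bounds all derivatives throughout Q.
From a point where the modulus is at least μ, some segment in Q meets any large subset of Q in a set
of positive length (`exists_direction`). If the sum were tiny on that subset, a one-dimensional
Remez-type inequality (`norm_le_of_small_on_set`) would force the modulus below μ at the starting
point. So the sum is not tiny on at least half of the guaranteed part of S ∩ Q
(`setLIntegral_le_of_good`), and summing over good boxes gives the inequality for p < ∞ and positive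
b. Vanishing sides b_j are reached by a limit in b, and p = ∞ by letting p tend to infinity. -/

/-- The exponential sum with coefficients `c k` and real frequencies `ξ k`, `k ∈ s`. -/
noncomputable def expSum {ι : Type*} {d : ℕ} (s : Finset ι) (c : ι → ℂ) (ξ : ι → Fin d → ℝ)
    (x : Fin d → ℝ) : ℂ :=
  ∑ k ∈ s, c k * Complex.exp (((ξ k ⬝ᵥ x : ℝ) : ℂ) * Complex.I)

/-! ### Pointwise Bernstein inequality by translates -/

/-- A superposition of translates with nonnegative weights. -/
noncomputable def avgOp {ι E : Type*} [Add E] (W : ι → ℝ≥0∞) (h : ι → E) (u : E → ℝ≥0∞) (x : E) :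
    ℝ≥0∞ :=
  ∑' i, W i * u (x + h i)

lemma avgOp_mono {ι E : Type*} [Add E] (W : ι → ℝ≥0∞) (h : ι → E) : Monotone (avgOp W h) := by
  intro u v huv x
  exact ENNReal.tsum_le_tsum fun i => by gcongr; exact huv _

lemma avgOp_iterate_mono {ι E : Type*} [Add E] (W : ι → ℝ≥0∞) (h : ι → E) (N : ℕ) :
    Monotone ((avgOp W h)^[N]) := (avgOp_mono W h).iterate N

/-- The Bernoulli polynomial B₂(x) = x² - x + 1/6 satisfies B₂(ξ + 3/4) - B₂(ξ + 1/4) = ξ, and both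
arguments stay in [0, 1] for |ξ| ≤ 1/4. This is the triangle wave: continuous and periodic, hence
with summable 1/n² coefficients. The term n = 0 vanishes because 1/0 = 0. -/
lemma hasSum_sawtooth_real {ξ : ℝ} (h1 : |ξ| ≤ 1 / 4) :
    HasSum (fun n : ℕ => 1 / (Real.pi ^ 2 * (n : ℝ) ^ 2) *
      (Real.cos (2 * Real.pi * n * (ξ + 3 / 4)) - Real.cos (2 * Real.pi * n * (ξ + 1 / 4)))) ξ := by
  rw [abs_le] at h1
  have e1 := hasSum_one_div_nat_pow_mul_cos (k := 1) one_ne_zero (x := ξ + 3 / 4)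
    ⟨by linarith, by linarith⟩
  have e2 := hasSum_one_div_nat_pow_mul_cos (k := 1) one_ne_zero (x := ξ + 1 / 4)
    ⟨by linarith, by linarith⟩
  have key := (e1.sub e2).mul_left (1 / Real.pi ^ 2)
  have hpi := Real.pi_ne_zero
  convert! key using 1
  · ext n
    by_cases hn : (n : ℝ) = 0
    · simp [hn]
    field_simp
    ring
  · simp [Polynomial.bernoulli, Finset.sum_range_succ, bernoulli_one, bernoulli_two,
      Nat.factorial]
    field_simp
    ring

lemma exists_sawtooth_coeff : ∃ α β : ℕ → ℂ,
    (∀ n, ‖α n‖ ≤ 1 / (Real.pi ^ 2 * (n : ℝ) ^ 2)) ∧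
    (∀ n, ‖β n‖ ≤ 1 / (Real.pi ^ 2 * (n : ℝ) ^ 2)) ∧
    ∀ ξ : ℝ, |ξ| ≤ 1 / 4 → HasSum (fun n : ℕ =>
      α n * Complex.exp (((2 * Real.pi * n * ξ : ℝ) : ℂ) * Complex.I) +
      β n * Complex.exp (((-(2 * Real.pi * n * ξ) : ℝ) : ℂ) * Complex.I)) (ξ : ℂ) := by
  refine ⟨fun n => ((1 / (Real.pi ^ 2 * (n : ℝ) ^ 2) : ℝ) : ℂ) *
      ((Complex.exp (((2 * Real.pi * n * (3 / 4) : ℝ) : ℂ) * Complex.I) -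
      Complex.exp (((2 * Real.pi * n * (1 / 4) : ℝ) : ℂ) * Complex.I)) / 2),
    fun n => ((1 / (Real.pi ^ 2 * (n : ℝ) ^ 2) : ℝ) : ℂ) *
      ((Complex.exp (((-(2 * Real.pi * n * (3 / 4)) : ℝ) : ℂ) * Complex.I) -
      Complex.exp (((-(2 * Real.pi * n * (1 / 4)) : ℝ) : ℂ) * Complex.I)) / 2), ?_, ?_, ?_⟩
  · intro n
    rw [norm_mul, Complex.norm_real, Real.norm_of_nonneg (by positivity)]
    refine mul_le_of_le_one_right (by positivity) ?_
    rw [norm_div]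
    have := norm_sub_le (Complex.exp (((2 * Real.pi * n * (3 / 4) : ℝ) : ℂ) * Complex.I))
      (Complex.exp (((2 * Real.pi * n * (1 / 4) : ℝ) : ℂ) * Complex.I))
    rw [Complex.norm_exp_ofReal_mul_I, Complex.norm_exp_ofReal_mul_I] at this
    simp only [Complex.norm_ofNat]
    linarith
  · intro n
    rw [norm_mul, Complex.norm_real, Real.norm_of_nonneg (by positivity)]
    refine mul_le_of_le_one_right (by positivity) ?_
    rw [norm_div]
    have := norm_sub_le (Complex.exp (((-(2 * Real.pi * n * (3 / 4)) : ℝ) : ℂ) * Complex.I))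
      (Complex.exp (((-(2 * Real.pi * n * (1 / 4)) : ℝ) : ℂ) * Complex.I))
    rw [Complex.norm_exp_ofReal_mul_I, Complex.norm_exp_ofReal_mul_I] at this
    simp only [Complex.norm_ofNat]
    linarith
  · intro ξ hξ
    have key := (Complex.hasSum_ofReal).2 (hasSum_sawtooth_real hξ)
    convert! key using 2 with n
    have hexp : ∀ a b : ℝ, Complex.exp (((a + b : ℝ) : ℂ) * Complex.I) =
        Complex.exp ((a : ℂ) * Complex.I) * Complex.exp ((b : ℂ) * Complex.I) := by
      intro a b
      rw [← Complex.exp_add]; push_cast; ring_nf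
    have hcos : ∀ a : ℝ, ((Real.cos a : ℝ) : ℂ) = (Complex.exp ((a : ℂ) * Complex.I) +
        Complex.exp (((-a : ℝ) : ℂ) * Complex.I)) / 2 := by
      intro a
      rw [Complex.ofReal_cos, Complex.cos]; push_cast; rfl
    rw [Complex.ofReal_mul (1 / (Real.pi ^ 2 * (n : ℝ) ^ 2)), Complex.ofReal_sub (Real.cos _), hcos, hcos, mul_add, mul_add, neg_add, neg_add,
      hexp, hexp, hexp, hexp]
    push_cast
    ring

lemma expSum_add_single {ι : Type*} {d : ℕ} (s : Finset ι) (c : ι → ℂ) (ξ : ι → Fin d → ℝ)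
    (x : Fin d → ℝ) (j : Fin d) (t : ℝ) :
    expSum s c ξ (x + Pi.single j t) = ∑ k ∈ s,
      c k * Complex.exp (((ξ k ⬝ᵥ x : ℝ) : ℂ) * Complex.I) *
        Complex.exp (((ξ k j * t : ℝ) : ℂ) * Complex.I) := by
  refine Finset.sum_congr rfl fun k _ => ?_
  rw [dotProduct_add, dotProduct_single, mul_assoc, ← Complex.exp_add]
  push_cast
  ring_nf

/-- The translations and weights dominating partial derivatives of exponential sums. -/
noncomputable def bernsteinWeight {d : ℕ} (l b : Fin d → ℝ) (i : Fin d × ℕ × Bool) : ℝ≥0∞ :=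
  ENNReal.ofReal (l i.1 * (2 * b i.1 * (1 / (Real.pi ^ 2 * (i.2.1 : ℝ) ^ 2))))

/-- The translation vectors dominating partial derivatives of exponential sums. -/
noncomputable def bernsteinShift {d : ℕ} (b : Fin d → ℝ) (i : Fin d × ℕ × Bool) : Fin d → ℝ :=
  Pi.single i.1 (if i.2.2 then Real.pi * i.2.1 / b i.1 else -(Real.pi * i.2.1 / b i.1))

/-- By ζ(2) = π²/6 the two shifts in direction j contribute 2/3 of l_j b_j, rounded up here to l_j
b_j. This total weight plays the role of the Bernstein constant. -/
lemma tsum_bernsteinWeight_le {d : ℕ} {l b : Fin d → ℝ} (hl : ∀ j, 0 ≤ l j) (hb : ∀ j, 0 < b j) :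
    ∑' i, bernsteinWeight l b i ≤ ENNReal.ofReal (∑ j, l j * b j) := by
  rw [ENNReal.tsum_prod', tsum_fintype, ENNReal.ofReal_sum_of_nonneg
    (fun j _ => mul_nonneg (hl j) (hb j).le)]
  refine Finset.sum_le_sum fun j _ => ?_
  rw [ENNReal.tsum_prod']
  simp only [bernsteinWeight, tsum_fintype, Fintype.sum_bool, ← two_mul]
  rw [ENNReal.tsum_mul_left]
  have hs : HasSum (fun n : ℕ => l j * (2 * b j * (1 / (Real.pi ^ 2 * (n : ℝ) ^ 2))))
      (l j * (2 * b j * (1 / Real.pi ^ 2 * (Real.pi ^ 2 / 6)))) := by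
    refine ((HasSum.mul_left _ ?_).mul_left _)
    convert! hasSum_zeta_two.mul_left (1 / Real.pi ^ 2) using 2 with n
    rw [one_div, one_div, one_div, mul_inv]
  rw [← ENNReal.ofReal_tsum_of_nonneg (fun n => by have := hl j; have := (hb j).le; positivity)
    hs.summable, hs.tsum_eq, ← ENNReal.ofReal_ofNat, ← ENNReal.ofReal_mul (by norm_num)]
  apply ENNReal.ofReal_le_ofReal
  have : l j * (2 * b j * (1 / Real.pi ^ 2 * (Real.pi ^ 2 / 6))) = l j * b j / 3 := by
    have := Real.pi_ne_zero
    field_simp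
    ring
  rw [this]
  have := mul_nonneg (hl j) (hb j).le
  linarith

/-- The rescaled frequency ξ_j/(2b) lies in [-1/4, 1/4], where the triangle wave reproduces it. Each
exponential of that series, multiplied into the sum, is a translation by ±πn/b along the j-th axis.
-/
lemma enorm_expSum_mul_coord_le {ι : Type*} {d : ℕ} (s : Finset ι) (c : ι → ℂ)
    (ξ : ι → Fin d → ℝ) (j : Fin d) {b : ℝ} (hb : 0 < b) (hξ : ∀ k ∈ s, |ξ k j| ≤ b / 2)
    (x : Fin d → ℝ) :
    ‖expSum s (fun k => c k * (ξ k j : ℂ)) ξ x‖ₑ ≤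
      ∑' n : ℕ, ENNReal.ofReal (2 * b * (1 / (Real.pi ^ 2 * (n : ℝ) ^ 2))) *
        (‖expSum s c ξ (x + Pi.single j (Real.pi * n / b))‖ₑ +
          ‖expSum s c ξ (x + Pi.single j (-(Real.pi * n / b)))‖ₑ) := by
  obtain ⟨α, β, hα, hβ, hsum⟩ := exists_sawtooth_coeff
  have h1 : HasSum (fun n : ℕ => (2 * b : ℂ) *
      (α n * expSum s c ξ (x + Pi.single j (Real.pi * n / b)) +
        β n * expSum s c ξ (x + Pi.single j (-(Real.pi * n / b)))))
      (expSum s (fun k => c k * (ξ k j : ℂ)) ξ x) := by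
    have h2 : ∀ k ∈ s, HasSum (fun n : ℕ => (2 * b : ℂ) *
        (c k * Complex.exp (((ξ k ⬝ᵥ x : ℝ) : ℂ) * Complex.I)) *
        (α n * Complex.exp (((ξ k j * (Real.pi * n / b) : ℝ) : ℂ) * Complex.I) +
        β n * Complex.exp (((ξ k j * (-(Real.pi * n / b)) : ℝ) : ℂ) * Complex.I)))
        (c k * (ξ k j : ℂ) * Complex.exp (((ξ k ⬝ᵥ x : ℝ) : ℂ) * Complex.I)) := by
      intro k hk
      have h3 : |ξ k j / (2 * b)| ≤ 1 / 4 := by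
        rw [abs_div, abs_of_pos (by positivity : 0 < 2 * b), div_le_iff₀ (by positivity)]
        have := hξ k hk
        linarith
      have h4 := (hsum _ h3).mul_left ((2 * b : ℂ) *
        (c k * Complex.exp (((ξ k ⬝ᵥ x : ℝ) : ℂ) * Complex.I)))
      have hb' : (b : ℂ) ≠ 0 := by exact_mod_cast hb.ne'
      convert! h4 using 1
      · ext n
        have e1 : ξ k j * (Real.pi * n / b) = 2 * Real.pi * n * (ξ k j / (2 * b)) := by
          field_simp
        rw [mul_neg, e1]
      · push_cast
        field_simp
    have h5 := hasSum_sum h2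
    convert! h5 using 1
    ext n
    rw [expSum_add_single, expSum_add_single, Finset.mul_sum, Finset.mul_sum,
      ← Finset.sum_add_distrib, Finset.mul_sum]
    refine Finset.sum_congr rfl fun k _ => ?_
    ring
  rw [← h1.tsum_eq]
  refine (enorm_tsum_le_tsum_enorm).trans (ENNReal.tsum_le_tsum fun n => ?_)
  have hen : ∀ z : ℂ, ‖z‖ ≤ 1 / (Real.pi ^ 2 * (n : ℝ) ^ 2) →
      ‖z‖ₑ ≤ ENNReal.ofReal (1 / (Real.pi ^ 2 * (n : ℝ) ^ 2)) := by
    intro z hz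
    rw [← ofReal_norm]
    exact ENNReal.ofReal_le_ofReal hz
  have h2b : ‖(2 * b : ℂ)‖ₑ = ENNReal.ofReal (2 * b) := by
    rw [← ofReal_norm]
    simp [abs_of_pos hb]
  rw [enorm_mul, h2b, ENNReal.ofReal_mul (p := 2 * b) (by positivity), mul_assoc]
  refine mul_le_mul' le_rfl ?_
  refine (enorm_add_le _ _).trans ?_
  rw [enorm_mul, enorm_mul, mul_add]
  gcongr
  · exact hen _ (hα n)
  · exact hen _ (hβ n)

lemma enorm_expSum_mul_dot_le {ι : Type*} {d : ℕ} (s : Finset ι) (c : ι → ℂ)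
    (ξ : ι → Fin d → ℝ) {l b : Fin d → ℝ} (hb : ∀ j, 0 < b j)
    (hξ : ∀ k ∈ s, ∀ j, |ξ k j| ≤ b j / 2) {w : Fin d → ℝ} (hw : ∀ j, |w j| ≤ l j)
    (x : Fin d → ℝ) :
    ‖expSum s (fun k => c k * ((ξ k ⬝ᵥ w : ℝ) : ℂ)) ξ x‖ₑ ≤
      avgOp (bernsteinWeight l b) (bernsteinShift b) (fun y => ‖expSum s c ξ y‖ₑ) x := by
  have h1 : expSum s (fun k => c k * ((ξ k ⬝ᵥ w : ℝ) : ℂ)) ξ x =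
      ∑ j, (w j : ℂ) * expSum s (fun k => c k * (ξ k j : ℂ)) ξ x := by
    simp only [expSum, Finset.mul_sum]
    rw [Finset.sum_comm]
    refine Finset.sum_congr rfl fun k _ => ?_
    simp only [dotProduct]
    push_cast
    rw [Finset.mul_sum, Finset.sum_mul]
    refine Finset.sum_congr rfl fun j _ => ?_
    ring
  rw [h1, avgOp, ENNReal.tsum_prod', tsum_fintype]
  refine (enorm_sum_le _ _).trans (Finset.sum_le_sum fun j _ => ?_)
  have hl : 0 ≤ l j := (abs_nonneg _).trans (hw j)
  rw [enorm_mul, ENNReal.tsum_prod']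
  have h2 : ‖(w j : ℂ)‖ₑ ≤ ENNReal.ofReal (l j) := by
    rw [← ofReal_norm, Complex.norm_real]
    exact ENNReal.ofReal_le_ofReal (hw j)
  refine (mul_le_mul' h2 (enorm_expSum_mul_coord_le s c ξ j (hb j)
    (fun k hk => hξ k hk j) x)).trans ?_
  rw [← ENNReal.tsum_mul_left]
  refine (ENNReal.tsum_le_tsum fun n => ?_)
  rw [tsum_fintype, Fintype.sum_bool]
  simp only [bernsteinWeight, bernsteinShift, ENNReal.ofReal_mul hl, if_true, Bool.false_eq_true,
    if_false]
  rw [← mul_assoc, mul_add]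

/-- Differentiation changes only the coefficients, so the first-order bound applies again to the
derivative; monotonicity of the averaging operator lets the bounds be composed. -/
lemma enorm_expSum_mul_dot_pow_le {ι : Type*} {d : ℕ} (s : Finset ι)
    (ξ : ι → Fin d → ℝ) {l b : Fin d → ℝ} (hb : ∀ j, 0 < b j)
    (hξ : ∀ k ∈ s, ∀ j, |ξ k j| ≤ b j / 2) {w : Fin d → ℝ} (hw : ∀ j, |w j| ≤ l j)
    (N : ℕ) : ∀ (c : ι → ℂ) (x : Fin d → ℝ),
    ‖expSum s (fun k => c k * ((ξ k ⬝ᵥ w : ℝ) : ℂ) ^ N) ξ x‖ₑ ≤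
      (avgOp (bernsteinWeight l b) (bernsteinShift b))^[N] (fun y => ‖expSum s c ξ y‖ₑ) x := by
  induction N with
  | zero => intro c x; simp
  | succ N ih =>
    intro c x
    have := ih (fun k => c k * ((ξ k ⬝ᵥ w : ℝ) : ℂ)) x
    simp only [mul_assoc, ← pow_succ'] at this
    refine this.trans ?_
    rw [Function.iterate_succ_apply]
    exact avgOp_iterate_mono _ _ N (fun y => enorm_expSum_mul_dot_le s c ξ hb hξ hw y) x

/-- Pointwise form of Bernstein's inequality for mixed directional derivatives. -/
lemma enorm_expSum_mul_dot_pow_mul_dot_pow_le {ι : Type*} {d : ℕ} (s : Finset ι)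
    (ξ : ι → Fin d → ℝ) {l b : Fin d → ℝ} (hb : ∀ j, 0 < b j)
    (hξ : ∀ k ∈ s, ∀ j, |ξ k j| ≤ b j / 2) {v w : Fin d → ℝ} (hv : ∀ j, |v j| ≤ l j)
    (hw : ∀ j, |w j| ≤ l j) (n m : ℕ) (c : ι → ℂ) (x : Fin d → ℝ) :
    ‖expSum s (fun k => c k * ((ξ k ⬝ᵥ v : ℝ) : ℂ) ^ n * ((ξ k ⬝ᵥ w : ℝ) : ℂ) ^ m) ξ x‖ₑ ≤
      (avgOp (bernsteinWeight l b) (bernsteinShift b))^[n + m]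
        (fun y => ‖expSum s c ξ y‖ₑ) x := by
  refine (enorm_expSum_mul_dot_pow_le s ξ hb hξ hw m _ x).trans ?_
  rw [add_comm, Function.iterate_add_apply]
  exact avgOp_iterate_mono _ _ m (fun y => enorm_expSum_mul_dot_pow_le s ξ hb hξ hv n c y) x

/-! ### Averages of periodic functions in L^p -/

/-- Jensen's inequality for weights that are not normalized, obtained from weighted Hölder on finite
partial sums. -/
lemma ENNReal.tsum_mul_rpow_le {ι : Type*} (W u : ι → ℝ≥0∞) {p : ℝ} (hp : 1 ≤ p) :
    (∑' i, W i * u i) ^ p ≤ (∑' i, W i) ^ (p - 1) * ∑' i, W i * u i ^ p := by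
  have hp0 : 0 < p := by linarith
  have h1 : ∑' i, W i * u i ≤ (∑' i, W i) ^ (1 - p⁻¹) * (∑' i, W i * u i ^ p) ^ p⁻¹ := by
    rw [ENNReal.tsum_eq_iSup_sum]
    refine iSup_le fun s => ?_
    refine (ENNReal.inner_le_weight_mul_Lp_of_nonneg s hp W u).trans ?_
    have : 0 ≤ 1 - p⁻¹ := by
      have := inv_le_one_of_one_le₀ hp
      linarith
    gcongr
    · exact ENNReal.sum_le_tsum s
    · exact ENNReal.sum_le_tsum s
  refine (ENNReal.rpow_le_rpow h1 hp0.le).trans ?_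
  rw [ENNReal.mul_rpow_of_nonneg _ _ hp0.le, ← ENNReal.rpow_mul, ← ENNReal.rpow_mul,
    inv_mul_cancel₀ hp0.ne', ENNReal.rpow_one]
  have : (1 - p⁻¹) * p = p - 1 := by
    field_simp
  rw [this]

/-- The half-open cube `[0, τ)^d`. -/
def halfOpenCell (d : ℕ) (τ : ℝ) : Set (Fin d → ℝ) := Set.univ.pi fun _ => Set.Ico 0 τ

/-- Periodicity with period `τ` in every coordinate. -/
def CoordPeriodic {d : ℕ} {α : Type*} (τ : ℝ) (u : (Fin d → ℝ) → α) : Prop :=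
  ∀ j x, u (x + Pi.single j τ) = u x

/-- The cell and its translate are both fundamental domains of the lattice τℤ^d, so a periodic
function has the same integral over each. -/
lemma CoordPeriodic.setLIntegral_add {d : ℕ} {τ : ℝ} (hτ : 0 < τ) {u : (Fin d → ℝ) → ℝ≥0∞}
    (hu : CoordPeriodic τ u) (h : Fin d → ℝ) :
    ∫⁻ x in halfOpenCell d τ, u (x + h) = ∫⁻ x in halfOpenCell d τ, u x := by
  let b : Module.Basis (Fin d) ℝ (Fin d → ℝ) :=
    (Pi.basisFun ℝ (Fin d)).unitsSMul fun _ => Units.mk0 τ hτ.ne'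
  have hb : ∀ j, b j = Pi.single j τ := by
    intro j
    ext i
    simp [b, Module.Basis.unitsSMul_apply, Pi.single_apply, Units.smul_def]
  have hcell : ZSpan.fundamentalDomain b = halfOpenCell d τ := by
    ext x
    simp only [ZSpan.mem_fundamentalDomain, halfOpenCell, Set.mem_pi, Set.mem_univ, true_imp_iff]
    refine forall_congr' fun i => ?_
    have : b.repr x i = τ⁻¹ * x i := by
      simp [b, Module.Basis.repr_unitsSMul, Units.smul_def]
    rw [this, Set.mem_Ico, Set.mem_Ico, inv_mul_lt_iff₀ hτ, mul_one]
    simp [hτ]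
  have hper : ∀ g ∈ Submodule.span ℤ (Set.range b), ∀ x, u (g + x) = u x := by
    intro g hg
    induction hg using Submodule.span_induction with
    | mem g hg =>
      obtain ⟨j, rfl⟩ := hg
      intro x
      rw [hb, add_comm, hu j x]
    | zero => simp
    | add g g' _ _ h1 h2 => intro x; rw [add_assoc, h1, h2]
    | smul n g _ h1 =>
      induction n using Int.induction_on with
      | zero => simp
      | succ n ih => intro x; rw [add_smul, one_smul, add_assoc, ih, h1]
      | pred n ih =>
        intro x
        rw [← h1, ← add_assoc, sub_smul, one_smul, add_sub_cancel, ih]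
  have hfd := ZSpan.isAddFundamentalDomain' b (volume : Measure (Fin d → ℝ))
  have hfd' := hfd.vadd_of_comm h
  have : Countable (Submodule.span ℤ (Set.range b)).toAddSubgroup :=
    inferInstanceAs (Countable (Submodule.span ℤ (Set.range b)))
  have e1 := hfd.setLIntegral_eq hfd' u (fun g x => hper g g.2 x)
  rw [← hcell, e1]
  have e2 := (measurePreserving_add_right volume h).setLIntegral_comp_emb
    (MeasurableEquiv.addRight h).measurableEmbedding u (ZSpan.fundamentalDomain b)
  refine e2.trans ?_
  congr 2
  ext x
  simp only [Set.mem_vadd_set, Set.mem_image, vadd_eq_add, add_comm]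

lemma CoordPeriodic.avgOp_coordPeriodic {ι : Type*} {d : ℕ} {τ : ℝ} {u : (Fin d → ℝ) → ℝ≥0∞}
    (hu : CoordPeriodic τ u) (W : ι → ℝ≥0∞) (h : ι → Fin d → ℝ) :
    CoordPeriodic τ (avgOp W h u) := by
  intro j x
  refine tsum_congr fun i => ?_
  rw [add_right_comm, hu]

lemma measurable_avgOp {ι : Type*} [Countable ι] {d : ℕ} {u : (Fin d → ℝ) → ℝ≥0∞}
    (hu : Measurable u) (W : ι → ℝ≥0∞) (h : ι → Fin d → ℝ) : Measurable (avgOp W h u) :=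
  Measurable.tsum fun i => (hu.comp (measurable_id.add_const (h i))).const_mul (W i)

/-- Jensen moves the power inside the sum over shifts, and translation invariance makes all the
resulting integrals equal: the L^p operator norm is at most the total weight. -/
lemma CoordPeriodic.setLIntegral_avgOp_rpow_le {ι : Type*} [Countable ι] {d : ℕ} {τ : ℝ}
    (hτ : 0 < τ) {u : (Fin d → ℝ) → ℝ≥0∞} (hu : CoordPeriodic τ u) (hm : Measurable u)
    (W : ι → ℝ≥0∞) (h : ι → Fin d → ℝ) {p : ℝ} (hp : 1 ≤ p) :
    ∫⁻ x in halfOpenCell d τ, avgOp W h u x ^ p ≤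
      (∑' i, W i) ^ p * ∫⁻ x in halfOpenCell d τ, u x ^ p := by
  have hup : CoordPeriodic τ fun x => u x ^ p := fun j x => by simp only [hu j x]
  calc ∫⁻ x in halfOpenCell d τ, avgOp W h u x ^ p
      ≤ ∫⁻ x in halfOpenCell d τ, (∑' i, W i) ^ (p - 1) * ∑' i, W i * u (x + h i) ^ p :=
        lintegral_mono fun x => ENNReal.tsum_mul_rpow_le W _ hp
    _ = (∑' i, W i) ^ (p - 1) * ∑' i, W i * ∫⁻ x in halfOpenCell d τ, u x ^ p := by
        have hmi : ∀ i, Measurable fun x => u (x + h i) ^ p := fun i =>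
          (hm.comp (measurable_id.add_const (h i))).pow_const p
        rw [lintegral_const_mul _ (Measurable.tsum fun i => (hmi i).const_mul _),
          lintegral_tsum fun i => ((hmi i).const_mul _).aemeasurable]
        congr 1
        refine tsum_congr fun i => ?_
        rw [lintegral_const_mul _ (hmi i), hup.setLIntegral_add hτ (h i)]
    _ = (∑' i, W i) ^ p * ∫⁻ x in halfOpenCell d τ, u x ^ p := by
        rw [ENNReal.tsum_mul_right, ← mul_assoc]
        congr 1
        nth_rewrite 2 [← ENNReal.rpow_one (∑' i, W i)]
        rw [← ENNReal.rpow_add_of_nonneg _ _ (by linarith) zero_le_one, sub_add_cancel]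

lemma CoordPeriodic.iterate_avgOp {ι : Type*} [Countable ι] {d : ℕ} {τ : ℝ}
    (hτ : 0 < τ) {u : (Fin d → ℝ) → ℝ≥0∞} (hu : CoordPeriodic τ u) (hm : Measurable u)
    (W : ι → ℝ≥0∞) (h : ι → Fin d → ℝ) {p : ℝ} (hp : 1 ≤ p) (N : ℕ) :
    CoordPeriodic τ ((avgOp W h)^[N] u) ∧ Measurable ((avgOp W h)^[N] u) ∧
    ∫⁻ x in halfOpenCell d τ, ((avgOp W h)^[N] u x) ^ p ≤
      ((∑' i, W i) ^ p) ^ N * ∫⁻ x in halfOpenCell d τ, u x ^ p := by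
  induction N with
  | zero => simpa using ⟨hu, hm⟩
  | succ N ih =>
    obtain ⟨h1, h2, h3⟩ := ih
    rw [Function.iterate_succ_apply']
    refine ⟨h1.avgOp_coordPeriodic W h, measurable_avgOp h2 W h, ?_⟩
    refine (h1.setLIntegral_avgOp_rpow_le hτ h2 W h hp).trans ?_
    rw [pow_succ', mul_assoc]
    gcongr

/-! ### One-dimensional Remez-type inequality -/

/-- A set of reals of measure larger than `n * h` contains `n + 1` points with gaps at least `h`. -/
lemma exists_separated_points {h : ℝ} (hh : 0 ≤ h) (n : ℕ) : ∀ (G : Set ℝ), BddAbove G →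
    ENNReal.ofReal (n * h) < volume G →
    ∃ t : ℕ → ℝ, (∀ i ≤ n, t i ∈ G) ∧ ∀ i < n, t i + h ≤ t (i + 1) := by
  induction n with
  | zero =>
    intro G _ hG
    obtain ⟨x, hx⟩ := nonempty_of_measure_ne_zero (hG.trans_le' zero_le).ne'
    exact ⟨fun _ => x, fun _ _ => hx, by simp⟩
  | succ n ih =>
    intro G hbdd hG
    have hGne : G.Nonempty := nonempty_of_measure_ne_zero (hG.trans_le' zero_le).ne'
    obtain ⟨r, hr1, hr2, hr3⟩ := ENNReal.lt_iff_exists_real_btwn.1 hG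
    have hr4 : ((n + 1 : ℕ) : ℝ) * h < r := (ENNReal.ofReal_lt_ofReal_iff_of_nonneg
      (by positivity)).1 hr2
    push_cast at hr4
    -- The surplus of measure allows the last point y to be taken within τ of the supremum.
    -- Discarding [y - h, sup G] then costs less than h + τ, which leaves more than n * h for the
    -- induction.
    set τ := r - (n + 1) * h with hτ
    have hτ0 : 0 < τ := by linarith
    obtain ⟨y, hyG, hy⟩ := exists_lt_of_lt_csSup hGne (sub_lt_self (sSup G) hτ0)
    have hsub : G ⊆ (G ∩ Set.Iio (y - h)) ∪ Set.Icc (y - h) (sSup G) := by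
      intro x hx
      by_cases hxy : x < y - h
      · exact Or.inl ⟨hx, hxy⟩
      · exact Or.inr ⟨not_lt.1 hxy, le_csSup hbdd hx⟩
    have hvol : ENNReal.ofReal (n * h) < volume (G ∩ Set.Iio (y - h)) := by
      by_contra hcon
      rw [not_lt] at hcon
      have h1 : volume G ≤ ENNReal.ofReal (n * h) + ENNReal.ofReal (sSup G - (y - h)) := by
        refine (measure_mono hsub).trans ((measure_union_le _ _).trans ?_)
        rw [Real.volume_Icc]
        gcongr
      have hyS : y ≤ sSup G := le_csSup hbdd hyG
      rw [← ENNReal.ofReal_add (by positivity) (by linarith)] at h1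
      have h2 := (hr3.trans_le h1)
      rw [ENNReal.ofReal_lt_ofReal_iff_of_nonneg hr1] at h2
      linarith
    obtain ⟨t, ht1, ht2⟩ := ih (G ∩ Set.Iio (y - h)) (hbdd.mono Set.inter_subset_left) hvol
    refine ⟨fun i => if i ≤ n then t i else y, ?_, ?_⟩
    · intro i hi
      by_cases hin : i ≤ n
      · simpa [hin] using (ht1 i hin).1
      · simpa [hin] using hyG
    · intro i hi
      have hin : i ≤ n := by omega
      by_cases hin' : i + 1 ≤ n
      · simpa [hin, hin'] using ht2 i (by omega)
      · have := (ht1 i hin).2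
        simp only [Set.mem_Iio] at this
        simp only [hin, hin', if_true, if_false]
        linarith

/-- Iterated Rolle theorem. -/
lemma exists_iterated_rolle (n : ℕ) : ∀ (Φ : ℕ → ℝ → ℝ), (∀ k x, HasDerivAt (Φ k) (Φ (k + 1) x) x) →
    ∀ t : ℕ → ℝ, (∀ i < n, t i < t (i + 1)) → (∀ i ≤ n, Φ 0 (t i) = 0) →
    ∃ x ∈ Set.Icc (t 0) (t n), Φ n x = 0 := by
  induction n with
  | zero => intro Φ _ t _ h0; exact ⟨t 0, by simp, h0 0 le_rfl⟩
  | succ n ih =>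
    intro Φ hΦ t ht h0
    have h1 : ∀ i, ∃ y, i ≤ n → (y ∈ Set.Ioo (t i) (t (i + 1)) ∧ Φ 1 y = 0) := by
      intro i
      by_cases hi : i ≤ n
      · obtain ⟨y, hy, hy'⟩ := exists_hasDerivAt_eq_zero (f := Φ 0) (f' := Φ 1) (ht i (by omega))
          (fun x _ => (hΦ 0 x).continuousAt.continuousWithinAt)
          (by rw [h0 i (by omega), h0 (i + 1) (by omega)]) (fun x _ => hΦ 0 x)
        exact ⟨y, fun _ => ⟨hy, hy'⟩⟩
      · exact ⟨0, fun h => absurd h hi⟩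
    choose s hs using h1
    obtain ⟨x, hx, hx'⟩ := ih (fun k => Φ (k + 1)) (fun k x => hΦ (k + 1) x) s
      (fun i hi => ((hs i hi.le).1.2.trans ((hs (i + 1) hi).1.1)))
      (fun i hi => (hs i hi).2)
    exact ⟨x, ⟨(hs 0 (by omega)).1.1.le.trans hx.1, hx.2.trans (hs n le_rfl).1.2.le⟩, hx'⟩

/-- Divided differences are values of derivatives. -/
lemma exists_sum_div_prod_eq (n : ℕ) (Φ : ℕ → ℝ → ℝ)
    (hΦ : ∀ k x, HasDerivAt (Φ k) (Φ (k + 1) x) x) (t : ℕ → ℝ) (ht : ∀ i < n, t i < t (i + 1)) :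
    ∃ x ∈ Set.Icc (t 0) (t n), Φ n x = n.factorial *
      ∑ i ∈ Finset.range (n + 1), Φ 0 (t i) / ∏ j ∈ (Finset.range (n + 1)).erase i, (t i - t j) := by
  have hmono : StrictMonoOn t (Set.Icc 0 n) := by
    refine strictMonoOn_of_lt_add_one Set.ordConnected_Icc fun a _ ha ha' => ht a ?_
    have := ha'.2
    omega
  have hinj : Set.InjOn t (Finset.range (n + 1)) := by
    refine hmono.injOn.mono ?_
    intro i hi
    simp only [Finset.coe_range, Set.mem_Iio] at hi
    exact ⟨Nat.zero_le _, by omega⟩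
  -- The function minus its Lagrange interpolant vanishes at all n + 1 nodes, so Rolle gives a zero
  -- of its n-th derivative; that of the interpolant is the constant n! times the divided
  -- difference.
  set P := Lagrange.interpolate (Finset.range (n + 1)) t (fun i => Φ 0 (t i)) with hP
  obtain ⟨x, hx, hx'⟩ := exists_iterated_rolle n
    (fun k x => Φ k x - (Polynomial.derivative^[k] P).eval x)
    (fun k x => by
      rw [Function.iterate_succ_apply']
      exact (hΦ k x).sub (Polynomial.hasDerivAt _ x)) t ht
    (fun i hi => by
      have := Lagrange.eval_interpolate_at_node (fun i => Φ 0 (t i)) hinj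
        (Finset.mem_range.2 (Nat.lt_succ_of_le hi))
      simp only [Function.iterate_zero, id_eq]
      rw [hP, this, sub_self])
  refine ⟨x, hx, ?_⟩
  rw [sub_eq_zero] at hx'
  rw [hx', Lagrange.eval_iterate_derivative_eq_sum hinj
    (Lagrange.degree_interpolate_lt _ hinj) (by simp) x]
  congr 1
  refine Finset.sum_congr rfl fun i hi => ?_
  rw [Lagrange.eval_interpolate_at_node _ hinj hi]
  simp

lemma prod_range_succ_erase_succ (n k : ℕ) (f : ℕ → ℝ) :
    ∏ j ∈ (Finset.range (n + 1)).erase (k + 1), f j =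
      f 0 * ∏ j ∈ (Finset.range n).erase k, f (j + 1) := by
  have h1 : ∏ j ∈ (Finset.range (n + 1)).erase (k + 1), f j =
      ∏ j ∈ Finset.range (n + 1), Function.update f (k + 1) 1 j := by
    rw [← Finset.prod_erase _ (Function.update_self (k + 1) (1 : ℝ) f)]
    refine Finset.prod_congr rfl fun j hj => ?_
    rw [Function.update_of_ne (Finset.ne_of_mem_erase hj)]
  have h2 : ∏ j ∈ (Finset.range n).erase k, f (j + 1) =
      ∏ j ∈ Finset.range n, Function.update f (k + 1) 1 (j + 1) := by
    rw [← Finset.prod_erase (Finset.range n) (a := k)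
      (f := fun j => Function.update f (k + 1) 1 (j + 1)) (Function.update_self _ _ _)]
    refine Finset.prod_congr rfl fun j hj => ?_
    rw [Function.update_of_ne]
    have := Finset.ne_of_mem_erase hj
    omega
  rw [h1, h2, Finset.prod_range_succ', mul_comm]
  congr 1

/-- Gaps add up to |s i - s j| ≥ h |i - j|. The indices below i contribute i! and those above
contribute (m - i)!, exactly as for equally spaced nodes. -/
lemma pow_mul_factorial_le_prod_abs_sub {h : ℝ} (hh : 0 ≤ h) (s : ℕ → ℝ) (m : ℕ)
    (hs : ∀ i < m, s i + h ≤ s (i + 1)) (i : ℕ) (hi : i ≤ m) :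
    h ^ m * (i.factorial * (m - i).factorial) ≤
      ∏ j ∈ (Finset.range (m + 1)).erase i, |s i - s j| := by
  have hgap : ∀ k i, i + k ≤ m → k * h ≤ s (i + k) - s i := by
    intro k
    induction k with
    | zero => intro i _; simp
    | succ k ih =>
      intro i hik
      have := ih i (by omega)
      have := hs (i + k) (by omega)
      push_cast
      rw [← add_assoc]
      linarith
  have hmain : ∀ k, i + k ≤ m → h ^ (i + k) * (i.factorial * k.factorial) ≤
      ∏ j ∈ (Finset.range (i + k + 1)).erase i, |s i - s j| := by
    intro k
    induction k with
    | zero =>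
      intro _
      rw [add_zero, Finset.range_add_one, Finset.erase_insert (by simp), Nat.factorial_zero,
        Nat.cast_one, mul_one, ← Finset.prod_range_add_one_eq_factorial, ← Finset.prod_range_reflect]
      push_cast
      rw [← Finset.card_range i, ← Finset.prod_const, Finset.card_range, ← Finset.prod_mul_distrib]
      refine Finset.prod_le_prod (fun j _ => by positivity) fun j hj => ?_
      have hj' := Finset.mem_range.1 hj
      have h1 := hgap (i - j) j (by omega)
      rw [Nat.add_sub_cancel' hj'.le] at h1
      refine le_trans (le_of_eq ?_) (h1.trans (le_abs_self _))
      rw [Nat.cast_sub hj'.le, Nat.cast_sub (by omega), Nat.cast_sub (by omega)]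
      push_cast
      ring
    | succ k ih =>
      intro hik
      have h1 := ih (by omega)
      rw [← add_assoc, Finset.range_add_one, Finset.erase_insert_of_ne (by omega),
        Finset.prod_insert (by simp)]
      have h2 := hgap (k + 1) i hik
      have h3 : ((k + 1 : ℕ) : ℝ) * h ≤ |s i - s (i + k + 1)| := by
        rw [abs_sub_comm]
        exact h2.trans (le_abs_self _)
      calc h ^ (i + k + 1) * (i.factorial * (k + 1).factorial)
          = ((k + 1 : ℕ) : ℝ) * h * (h ^ (i + k) * (i.factorial * k.factorial)) := by
            rw [Nat.factorial_succ]; push_cast; ring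
        _ ≤ _ := mul_le_mul h3 h1 (by positivity) (abs_nonneg _)
  have := hmain (m - i) (by omega)
  rwa [Nat.add_sub_cancel' hi] at this

/-- A Remez-type inequality for smooth real functions: small values on a set of positive measure
and a bound on one derivative control the value at an endpoint. -/
lemma abs_le_of_small_on_set_real {Φ : ℕ → ℝ → ℝ} (hΦ : ∀ k x, HasDerivAt (Φ k) (Φ (k + 1) x) x)
    {G : Set ℝ} (hG : G ⊆ Set.Icc 0 1) {η : ℝ} (hη : 0 < η) (hGη : ENNReal.ofReal η ≤ volume G)
    {lam : ℝ} (hlam : 0 ≤ lam) (hsmall : ∀ x ∈ G, |Φ 0 x| ≤ lam) {M : ℝ} (m : ℕ)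
    (hM : ∀ x ∈ Set.Icc (0 : ℝ) 1, |Φ (m + 1) x| ≤ M) :
    |Φ 0 0| ≤ (2 * (m + 1) / η) ^ m / m.factorial * lam + M / (m + 1).factorial := by
  -- Choosing m + 1 points needs only m gaps, and m * h < η strictly.
  set h := η / (m + 1) with hh
  have hh0 : 0 < h := by positivity
  have hvol : ENNReal.ofReal (m * h) < volume (G \ {0}) := by
    rw [measure_sdiff_null (by simp)]
    refine lt_of_lt_of_le ?_ hGη
    rw [ENNReal.ofReal_lt_ofReal_iff hη, hh, mul_div_assoc', div_lt_iff₀ (by positivity)]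
    nlinarith
  obtain ⟨s, hs1, hs2⟩ := exists_separated_points hh0.le m (G \ {0})
    ⟨1, fun x hx => (hG hx.1).2⟩ hvol
  have hs0 : ∀ i ≤ m, 0 < s i ∧ s i ≤ 1 := fun i hi =>
    ⟨lt_of_le_of_ne (hG (hs1 i hi).1).1 (Ne.symm (hs1 i hi).2), (hG (hs1 i hi).1).2⟩
  -- The point 0 is prepended as a node, which is why it was removed from G: there are m + 2
  -- distinct nodes, and the divided difference is a derivative of order m + 1.
  let t : ℕ → ℝ := fun i => Nat.casesOn i 0 s
  have ht0 : t 0 = 0 := rfl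
  have hts : ∀ i, t (i + 1) = s i := fun i => rfl
  obtain ⟨x, hx, hx'⟩ := exists_sum_div_prod_eq (m + 1) Φ hΦ t (by
    intro i hi
    cases i with
    | zero => exact (hs0 0 (by omega)).1
    | succ i =>
      have := hs2 i (by omega)
      rw [hts, hts]
      linarith)
  have hx01 : x ∈ Set.Icc (0 : ℝ) 1 := ⟨hx.1, hx.2.trans (hs0 m le_rfl).2⟩
  have hMx := hM x hx01
  -- Solving the divided difference for the value at 0 multiplies everything by Q. Since Q ≤ 1, the
  -- derivative term does not grow; since Q ≤ s i, the factor s i - 0 in the i-th denominator is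
  -- absorbed.
  set Q := ∏ j ∈ Finset.range (m + 1), s j with hQ
  have hQ0 : 0 < Q := Finset.prod_pos fun j hj => (hs0 j (by simpa [Nat.lt_succ_iff] using hj)).1
  have hQ1 : Q ≤ 1 := Finset.prod_le_one
    (fun j hj => (hs0 j (by simpa [Nat.lt_succ_iff] using hj)).1.le)
    (fun j hj => (hs0 j (by simpa [Nat.lt_succ_iff] using hj)).2)
  rw [Finset.sum_range_succ'] at hx'
  have hzero : |∏ j ∈ (Finset.range (m + 1 + 1)).erase 0, (t 0 - t j)| = Q := by
    have : (Finset.range (m + 1 + 1)).erase 0 = (Finset.range (m + 1)).image Nat.succ := by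
      ext j
      simp only [Finset.mem_erase, Finset.mem_range, Finset.mem_image]
      constructor
      · rintro ⟨h1, h2⟩
        exact ⟨j - 1, by omega, by omega⟩
      · rintro ⟨a, h1, rfl⟩
        exact ⟨by omega, by omega⟩
    rw [this, Finset.prod_image (by simp), Finset.abs_prod]
    refine Finset.prod_congr rfl fun j hj => ?_
    rw [ht0, Nat.succ_eq_add_one, hts, zero_sub, abs_neg,
      abs_of_pos (hs0 j (by simpa [Nat.lt_succ_iff] using hj)).1]
  set Z := ∏ j ∈ (Finset.range (m + 1 + 1)).erase 0, (t 0 - t j) with hZ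
  set R := ∑ i ∈ Finset.range (m + 1), Φ 0 (t (i + 1)) /
    ∏ j ∈ (Finset.range (m + 1 + 1)).erase (i + 1), (t (i + 1) - t j) with hR
  have hZ0 : Z ≠ 0 := by
    intro h0
    rw [h0, abs_zero] at hzero
    exact hQ0.ne hzero
  have hfac : (0 : ℝ) < (m + 1).factorial := by positivity
  have hval : Φ 0 0 = Z * (Φ (m + 1) x / (m + 1).factorial - R) := by
    rw [hx', ht0]
    field_simp
    ring
  have hRle : Q * |R| ≤ (2 * (m + 1) / η) ^ m / m.factorial * lam := by
    have hterm : ∀ i ∈ Finset.range (m + 1),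
        Q * |Φ 0 (t (i + 1)) /
          ∏ j ∈ (Finset.range (m + 1 + 1)).erase (i + 1), (t (i + 1) - t j)| ≤
        lam * (1 / h ^ m * (m.choose i / m.factorial)) := by
      intro i hi
      have him : i ≤ m := Nat.lt_succ_iff.1 (Finset.mem_range.1 hi)
      rw [prod_range_succ_erase_succ, ht0, abs_div, abs_mul, Finset.abs_prod, hts, sub_zero,
        abs_of_pos (hs0 i him).1]
      have hlow := pow_mul_factorial_le_prod_abs_sub hh0.le s m hs2 i him
      have hQi : Q ≤ s i := by
        rw [hQ, ← Finset.mul_prod_erase _ _ hi]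
        refine mul_le_of_le_one_right (hs0 i him).1.le (Finset.prod_le_one ?_ ?_)
        · intro j hj
          exact (hs0 j (by simpa [Nat.lt_succ_iff] using Finset.mem_of_mem_erase hj)).1.le
        · intro j hj
          exact (hs0 j (by simpa [Nat.lt_succ_iff] using Finset.mem_of_mem_erase hj)).2
      have hsm : |Φ 0 (s i)| ≤ lam := hsmall _ (hs1 i him).1
      have hpos : 0 < h ^ m * ((i.factorial : ℝ) * (m - i).factorial) := by positivity
      simp only [hts]
      calc Q * (|Φ 0 (s i)| / (s i * ∏ j ∈ (Finset.range (m + 1)).erase i, |s i - s j|))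
          ≤ s i * (lam / (s i * (h ^ m * ((i.factorial : ℝ) * (m - i).factorial)))) := by
            have := (hs0 i him).1
            gcongr
        _ = lam * (1 / h ^ m * (m.choose i / m.factorial)) := by
            rw [Nat.cast_choose ℝ him]
            have := (hs0 i him).1.ne'
            have h2 : (m.factorial : ℝ) ≠ 0 := by positivity
            field_simp
    calc Q * |R| ≤ Q * ∑ i ∈ Finset.range (m + 1), |Φ 0 (t (i + 1)) /
          ∏ j ∈ (Finset.range (m + 1 + 1)).erase (i + 1), (t (i + 1) - t j)| := by
          gcongr
          exact Finset.abs_sum_le_sum_abs _ _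
      _ ≤ ∑ i ∈ Finset.range (m + 1), lam * (1 / h ^ m * (m.choose i / m.factorial)) := by
          rw [Finset.mul_sum]
          exact Finset.sum_le_sum hterm
      _ = (2 * (m + 1) / η) ^ m / m.factorial * lam := by
          rw [← Finset.mul_sum, ← Finset.mul_sum, ← Finset.sum_div, ← Nat.cast_sum,
            Nat.sum_range_choose, hh, div_pow, div_pow, mul_pow]
          push_cast
          field_simp
  rw [hval, abs_mul, hzero]
  calc Q * |Φ (m + 1) x / (m + 1).factorial - R|
      ≤ Q * (|Φ (m + 1) x / (m + 1).factorial| + |R|) := by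
        gcongr
        exact abs_sub _ _
    _ = Q * |Φ (m + 1) x / (m + 1).factorial| + Q * |R| := by ring
    _ ≤ M / (m + 1).factorial + (2 * (m + 1) / η) ^ m / m.factorial * lam := by
        refine add_le_add ?_ hRle
        refine (mul_le_of_le_one_left (abs_nonneg _) hQ1).trans ?_
        rw [abs_div, abs_of_pos hfac]
        gcongr
    _ = _ := add_comm _ _

/-- Complex-valued version of `abs_le_of_small_on_set_real`. -/
lemma norm_le_of_small_on_set {Φ : ℕ → ℝ → ℂ} (hΦ : ∀ k x, HasDerivAt (Φ k) (Φ (k + 1) x) x)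
    {G : Set ℝ} (hG : G ⊆ Set.Icc 0 1) {η : ℝ} (hη : 0 < η) (hGη : ENNReal.ofReal η ≤ volume G)
    {lam : ℝ} (hlam : 0 ≤ lam) (hsmall : ∀ x ∈ G, ‖Φ 0 x‖ ≤ lam) {M : ℝ} (m : ℕ)
    (hM : ∀ x ∈ Set.Icc (0 : ℝ) 1, ‖Φ (m + 1) x‖ ≤ M) :
    ‖Φ 0 0‖ ≤ (2 * (m + 1) / η) ^ m / m.factorial * lam + M / (m + 1).factorial := by
  -- A unimodular factor makes the value at 0 real and nonnegative; elsewhere passing to the real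
  -- part only decreases the modulus.
  obtain ⟨u, hu, hu'⟩ : ∃ u : ℂ, ‖u‖ = 1 ∧ u * Φ 0 0 = ‖Φ 0 0‖ := by
    by_cases h0 : Φ 0 0 = 0
    · exact ⟨1, by simp, by simp [h0]⟩
    · have hn : (‖Φ 0 0‖ : ℂ) ≠ 0 := by simpa using h0
      refine ⟨‖Φ 0 0‖ / Φ 0 0, ?_, ?_⟩
      · rw [norm_div, Complex.norm_real, norm_norm, div_self (by simpa using h0)]
      · field_simp
  have habs : ∀ z : ℂ, |(u * z).re| ≤ ‖z‖ := fun z =>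
    (Complex.abs_re_le_norm _).trans (by rw [norm_mul, hu, one_mul])
  have key := abs_le_of_small_on_set_real (Φ := fun k x => (u * Φ k x).re)
    (fun k x => by
      have := (hΦ k x).const_mul u
      exact (Complex.reCLM.hasFDerivAt.comp_hasDerivAt x this))
    hG hη hGη hlam (fun x hx => (habs _).trans (hsmall x hx)) m
    (fun x hx => (habs _).trans (hM x hx))
  simp only [hu', Complex.ofReal_re] at key
  exact (le_abs_self _).trans key

/-! ### Segments meeting a large subset of a convex body -/

open scoped Pointwise in
-- Every point of E lies in t • B or in the shell Q \ t • Q. The shell has relative volume 1 - t^d ≤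
-- ε/2, so at least ε/2 is left for B.
lemma volume_smul_section_ge {d : ℕ} {Q E : Set (Fin d → ℝ)} (hQ : Convex ℝ Q) (h0 : 0 ∈ Q)
    (hQm : MeasurableSet Q) (hQf : volume Q ≠ ∞) (hEQ : E ⊆ Q)
    {ε : ℝ} (hε : 0 < ε) (hE : ENNReal.ofReal ε * volume Q ≤ volume E) {t : ℝ} (ht0 : 0 < t)
    (ht1 : t ≤ 1) (ht : 1 - ε / 2 ≤ t ^ d) :
    ENNReal.ofReal (ε / 2) * volume Q ≤ volume {v | v ∈ Q ∧ t • v ∈ E} := by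
  set B := {v | v ∈ Q ∧ t • v ∈ E} with hB
  have htQ : t • Q ⊆ Q := by
    rintro _ ⟨v, hv, rfl⟩
    exact hQ.smul_mem_of_zero_mem h0 hv ⟨ht0.le, ht1⟩
  have hscale : ∀ A : Set (Fin d → ℝ), volume (t • A) = ENNReal.ofReal (t ^ d) * volume A := by
    intro A
    rw [Measure.addHaar_smul, abs_of_nonneg (by positivity)]
    simp
  have hcover : E ⊆ (t • B) ∪ (Q \ t • Q) := by
    intro y hy
    by_cases hyt : y ∈ t • Q
    · obtain ⟨v, hv, rfl⟩ := hyt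
      exact Or.inl ⟨v, ⟨hv, hy⟩, rfl⟩
    · exact Or.inr ⟨hEQ hy, hyt⟩
  have h1 : volume E ≤ volume B + volume (Q \ t • Q) := by
    refine (measure_mono hcover).trans ((measure_union_le _ _).trans (add_le_add ?_ le_rfl))
    rw [hscale]
    refine mul_le_of_le_one_left (zero_le) ?_
    rw [ENNReal.ofReal_le_one]
    exact pow_le_one₀ ht0.le ht1
  have h2 : ENNReal.ofReal (t ^ d) * volume Q + volume (Q \ t • Q) = volume Q := by
    rw [← hscale, ← measure_union Set.disjoint_sdiff_right
      (hQm.diff (hQm.const_smul_of_ne_zero ht0.ne')), Set.union_sdiff_cancel htQ]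
  have h3 : ENNReal.ofReal (ε / 2) * volume Q + volume Q ≤ volume B + volume Q := by
    calc ENNReal.ofReal (ε / 2) * volume Q + volume Q
        = ENNReal.ofReal (ε / 2 + 1) * volume Q := by
          rw [ENNReal.ofReal_add (by positivity) zero_le_one, add_mul, ENNReal.ofReal_one, one_mul]
      _ ≤ ENNReal.ofReal (ε + t ^ d) * volume Q := by
          exact mul_le_mul' (ENNReal.ofReal_le_ofReal (by linarith)) le_rfl
      _ = ENNReal.ofReal ε * volume Q + ENNReal.ofReal (t ^ d) * volume Q := by
          rw [ENNReal.ofReal_add hε.le (by positivity), add_mul]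
      _ ≤ (volume B + volume (Q \ t • Q)) + ENNReal.ofReal (t ^ d) * volume Q := by
          gcongr
          exact hE.trans h1
      _ = volume B + volume Q := by rw [add_assoc, add_comm (volume (Q \ t • Q)), h2]
  exact (ENNReal.add_le_add_iff_right hQf).1 h3

/-- Fubini on pairs (v, t) replaces polar coordinates: for t near 1 the dilated copy of Q still sees
much of E, so the average over v in Q of the time spent in E is large, and some v attains the
average. -/
lemma exists_direction_of_zero_mem {d : ℕ} (hd : 1 ≤ d) {Q E : Set (Fin d → ℝ)}
    (hQ : Convex ℝ Q) (h0 : 0 ∈ Q)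
    (hQm : MeasurableSet Q) (hQf : volume Q ≠ ∞) (hQ0 : volume Q ≠ 0)
    (hEm : MeasurableSet E) (hEQ : E ⊆ Q)
    {ε : ℝ} (hε : 0 < ε) (hε1 : ε ≤ 1) (hE : ENNReal.ofReal ε * volume Q ≤ volume E) :
    ∃ v ∈ Q, ENNReal.ofReal (ε ^ 2 / (4 * d)) ≤ volume {t : ℝ | t ∈ Set.Icc 0 1 ∧ t • v ∈ E} := by
  have hd0 : (0 : ℝ) < d := by exact_mod_cast hd
  have hd1 : (1 : ℝ) ≤ d := by exact_mod_cast hd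
  let A : Set ((Fin d → ℝ) × ℝ) := {z | z.1 ∈ Q ∧ (z.2 ∈ Set.Icc (0 : ℝ) 1 ∧ z.2 • z.1 ∈ E)}
  have hA : MeasurableSet A := by
    refine (measurable_fst hQm).inter ((measurable_snd measurableSet_Icc).inter ?_)
    exact (measurable_snd.smul measurable_fst) hEm
  have e1 := Measure.prod_apply (μ := (volume : Measure (Fin d → ℝ))) (ν := (volume : Measure ℝ)) hA
  have e2 := Measure.prod_apply_symm (μ := (volume : Measure (Fin d → ℝ)))
    (ν := (volume : Measure ℝ)) hA
  set g : (Fin d → ℝ) → ℝ≥0∞ := fun v => volume {t : ℝ | t ∈ Set.Icc 0 1 ∧ t • v ∈ E} with hg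
  have e3 : ∫⁻ v, volume (Prod.mk v ⁻¹' A) = ∫⁻ v in Q, g v := by
    rw [← lintegral_indicator hQm]
    refine lintegral_congr fun v => ?_
    by_cases hv : v ∈ Q
    · rw [Set.indicator_of_mem hv]
      simp [hg, A, hv]
    · rw [Set.indicator_of_notMem hv]
      simp [A, hv]
  have hlow : ENNReal.ofReal (ε ^ 2 / (4 * d)) * volume Q ≤ ∫⁻ v in Q, g v := by
    rw [← e3, ← e1, e2]
    -- For t ≥ 1 - ε/(2d), Bernoulli's inequality gives t^d ≥ 1 - ε/2. The product of ε/2 and the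
    -- length ε/(2d) of this range is ε²/(4d).
    have hsub : ENNReal.ofReal (ε / 2) * volume Q * ENNReal.ofReal (ε / (2 * d)) ≤
        ∫⁻ t in Set.Icc (1 - ε / (2 * d)) 1, volume ((fun v => (v, t)) ⁻¹' A) := by
      have hv : volume (Set.Icc (1 - ε / (2 * d)) 1) = ENNReal.ofReal (ε / (2 * d)) := by
        rw [Real.volume_Icc]
        congr 1
        ring
      rw [← hv, ← setLIntegral_const]
      refine setLIntegral_mono' measurableSet_Icc fun t ht => ?_
      have hεd : ε / (2 * d) ≤ 1 / 2 := by
        rw [div_le_div_iff₀ (by positivity) (by norm_num)]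
        nlinarith
      have ht0 : 0 < t := by linarith [ht.1]
      have htd : 1 - ε / 2 ≤ t ^ d := by
        have hB := one_add_mul_le_pow (a := t - 1) (by linarith) d
        have h2 : (d : ℝ) * (t - 1) ≥ -(ε / 2) := by
          have h3 : t - 1 ≥ -(ε / (2 * d)) := by linarith [ht.1]
          calc (d : ℝ) * (t - 1) ≥ d * -(ε / (2 * d)) := mul_le_mul_of_nonneg_left h3 hd0.le
            _ = -(ε / 2) := by field_simp
        rw [add_sub_cancel] at hB
        linarith
      refine (volume_smul_section_ge hQ h0 hQm hQf hEQ hε hE ht0 ht.2 htd).trans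
        (measure_mono ?_)
      rintro v ⟨hv1, hv2⟩
      exact ⟨hv1, ⟨ht0.le, ht.2⟩, hv2⟩
    refine le_trans (le_of_eq ?_) (hsub.trans (setLIntegral_le_lintegral _ _))
    rw [mul_right_comm, ← ENNReal.ofReal_mul (by positivity)]
    congr 2
    field_simp
    norm_num
  have hfin : ∫⁻ v in Q, g v ≠ ∞ := by
    refine ne_of_lt (lt_of_le_of_lt (b := ∫⁻ _ in Q, 1) (lintegral_mono fun v => ?_) ?_)
    · refine (measure_mono (t := Set.Icc (0 : ℝ) 1) fun t ht => ht.1).trans ?_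
      simp
    · simpa using hQf.lt_top
  obtain ⟨v, hv, hv'⟩ := exists_setLAverage_le hQ0 hQm.nullMeasurableSet hfin
  refine ⟨v, hv, le_trans ?_ hv'⟩
  rw [setLAverage_eq, ENNReal.le_div_iff_mul_le (Or.inl hQ0) (Or.inl hQf)]
  exact hlow

/-- From every point of a convex body `Q` there is a segment inside `Q` which meets a given subset
of positive relative measure in a set of positive relative length. -/
lemma exists_direction {d : ℕ} (hd : 1 ≤ d) {Q E : Set (Fin d → ℝ)}
    (hQ : Convex ℝ Q) {x : Fin d → ℝ} (hx : x ∈ Q)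
    (hQm : MeasurableSet Q) (hQf : volume Q ≠ ∞) (hQ0 : volume Q ≠ 0)
    (hEm : MeasurableSet E) (hEQ : E ⊆ Q)
    {ε : ℝ} (hε : 0 < ε) (hε1 : ε ≤ 1) (hE : ENNReal.ofReal ε * volume Q ≤ volume E) :
    ∃ v, x + v ∈ Q ∧
      ENNReal.ofReal (ε ^ 2 / (4 * d)) ≤ volume {t : ℝ | t ∈ Set.Icc 0 1 ∧ x + t • v ∈ E} := by
  have hvol : ∀ A : Set (Fin d → ℝ), volume ((fun y => x + y) ⁻¹' A) = volume A :=
    fun A => measure_preimage_add volume x A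
  exact exists_direction_of_zero_mem hd (Q := (fun y => x + y) ⁻¹' Q)
    (E := (fun y => x + y) ⁻¹' E) (hQ.translate_preimage_right x)
    (by simpa using hx) (measurable_const_add x hQm) (by rwa [hvol]) (by rwa [hvol])
    (measurable_const_add x hEm) (fun y hy => hEQ hy) hε hε1 (by rwa [hvol, hvol])

/-! ### Exponential sums on a good box -/

lemma continuous_expSum {ι : Type*} {d : ℕ} (s : Finset ι) (c : ι → ℂ) (ξ : ι → Fin d → ℝ) :
    Continuous (expSum s c ξ) := by
  unfold expSum
  simp only [dotProduct]
  fun_prop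

lemma norm_expSum_le {ι : Type*} {d : ℕ} (s : Finset ι) (c : ι → ℂ) (ξ : ι → Fin d → ℝ)
    (x : Fin d → ℝ) : ‖expSum s c ξ x‖ ≤ ∑ k ∈ s, ‖c k‖ := by
  refine (norm_sum_le _ _).trans (Finset.sum_le_sum fun k _ => ?_)
  rw [norm_mul, Complex.norm_exp_ofReal_mul_I, mul_one]

/-- Taylor expansion of exponential sums. -/
lemma hasSum_expSum_taylor {ι : Type*} {d : ℕ} (s : Finset ι) (c : ι → ℂ) (ξ : ι → Fin d → ℝ)
    (z w : Fin d → ℝ) :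
    HasSum (fun m : ℕ => Complex.I ^ m / (m.factorial : ℂ) *
      expSum s (fun k => c k * ((ξ k ⬝ᵥ w : ℝ) : ℂ) ^ m) ξ z) (expSum s c ξ (z + w)) := by
  have h1 : ∀ k ∈ s, HasSum (fun m : ℕ =>
      c k * Complex.exp (((ξ k ⬝ᵥ z : ℝ) : ℂ) * Complex.I) *
        ((((ξ k ⬝ᵥ w : ℝ) : ℂ) * Complex.I) ^ m / (m.factorial : ℂ)))
      (c k * Complex.exp (((ξ k ⬝ᵥ (z + w) : ℝ) : ℂ) * Complex.I)) := by
    intro k _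
    have h2 := NormedSpace.expSeries_div_hasSum_exp (((ξ k ⬝ᵥ w : ℝ) : ℂ) * Complex.I)
    rw [← Complex.exp_eq_exp_ℂ] at h2
    have h3 := h2.mul_left (c k * Complex.exp (((ξ k ⬝ᵥ z : ℝ) : ℂ) * Complex.I))
    convert! h3 using 1
    rw [mul_assoc, ← Complex.exp_add, dotProduct_add]
    push_cast
    ring_nf
  convert! hasSum_sum h1 using 1
  ext m
  rw [expSum, Finset.mul_sum]
  refine Finset.sum_congr rfl fun k _ => ?_
  rw [mul_pow]
  ring

lemma hasDerivAt_expSum_line {ι : Type*} {d : ℕ} (s : Finset ι) (c : ι → ℂ)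
    (ξ : ι → Fin d → ℝ) (x v : Fin d → ℝ) (t : ℝ) :
    HasDerivAt (fun t : ℝ => expSum s c ξ (x + t • v))
      (Complex.I * expSum s (fun k => c k * ((ξ k ⬝ᵥ v : ℝ) : ℂ)) ξ (x + t • v)) t := by
  have h1 : ∀ k ∈ s, HasDerivAt (fun t : ℝ =>
      c k * Complex.exp (((ξ k ⬝ᵥ (x + t • v) : ℝ) : ℂ) * Complex.I))
      (c k * (Complex.exp (((ξ k ⬝ᵥ (x + t • v) : ℝ) : ℂ) * Complex.I) *
        (((ξ k ⬝ᵥ v : ℝ) : ℂ) * Complex.I))) t := by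
    intro k _
    have h2 : HasDerivAt (fun t : ℝ => (ξ k ⬝ᵥ (x + t • v) : ℝ)) (ξ k ⬝ᵥ v) t := by
      simp only [dotProduct_add, dotProduct_smul, smul_eq_mul]
      simpa using ((hasDerivAt_id t).mul_const (ξ k ⬝ᵥ v)).const_add (ξ k ⬝ᵥ x)
    exact ((h2.ofReal_comp.mul_const Complex.I).cexp).const_mul (c k)
  have h3 := HasDerivAt.fun_sum h1
  convert! h3 using 1
  rw [expSum, Finset.mul_sum]
  refine Finset.sum_congr rfl fun k _ => ?_
  ring

/-- If the iterated averages at `z` are under control, all directional derivatives are under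
control near `z`. -/
lemma norm_expSum_deriv_le {ι : Type*} {d : ℕ} (s : Finset ι) (c : ι → ℂ)
    (ξ : ι → Fin d → ℝ) {l b : Fin d → ℝ} (hb : ∀ j, 0 < b j)
    (hξ : ∀ k ∈ s, ∀ j, |ξ k j| ≤ b j / 2) {B μ : ℝ} (hB : 0 ≤ B) (hμ : 0 ≤ μ) {z : Fin d → ℝ}
    (hz : ∀ N, (avgOp (bernsteinWeight l b) (bernsteinShift b))^[N]
      (fun y => ‖expSum s c ξ y‖ₑ) z ≤ ENNReal.ofReal (4 * B ^ N * μ))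
    {y v : Fin d → ℝ} (hy : ∀ j, |y j - z j| ≤ l j) (hv : ∀ j, |v j| ≤ l j) (n : ℕ) :
    ‖expSum s (fun k => c k * ((ξ k ⬝ᵥ v : ℝ) : ℂ) ^ n) ξ y‖ ≤
      4 * B ^ n * Real.exp B * μ := by
  -- The m-th Taylor coefficient at z is a mixed derivative of order n + m, so summing B^(n + m)/m!
  -- costs only the factor exp B.
  have h1 := hasSum_expSum_taylor s (fun k => c k * ((ξ k ⬝ᵥ v : ℝ) : ℂ) ^ n) ξ z (y - z)
  rw [add_sub_cancel] at h1
  have h2 : HasSum (fun m : ℕ => 4 * B ^ n * μ * (B ^ m / m.factorial))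
      (4 * B ^ n * μ * Real.exp B) := by
    have := NormedSpace.expSeries_div_hasSum_exp B
    rw [← Real.exp_eq_exp_ℝ] at this
    exact this.mul_left _
  rw [← h1.tsum_eq]
  refine (tsum_of_norm_bounded h2 fun m => ?_).trans (le_of_eq (by ring))
  have h3 := (enorm_expSum_mul_dot_pow_mul_dot_pow_le s ξ hb hξ hv (w := y - z) hy n m c z).trans
    (hz (n + m))
  rw [← ofReal_norm, ENNReal.ofReal_le_ofReal_iff (by positivity)] at h3
  rw [norm_mul, norm_div, norm_pow, Complex.norm_I, one_pow, Complex.norm_natCast]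
  calc 1 / (m.factorial : ℝ) * _ ≤ 1 / (m.factorial : ℝ) * (4 * B ^ (n + m) * μ) := by gcongr
    _ = 4 * B ^ n * μ * (B ^ m / m.factorial) := by rw [pow_add]; ring

/-- This balances the Remez-type inequality: a degree proportional to B makes the derivative term
small, and a value bound of size (η/180)^(180 B) defeats the interpolation constant. The strict
inequality is what yields the contradiction on a good box. -/
lemma remez_constants {B η : ℝ} (hB : 0 < B) (hη : 0 < η) (hη1 : η ≤ 1) :
    ∃ m : ℕ, (2 * (m + 1) / η) ^ m / m.factorial * (η / 180) ^ (180 * B) +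
      4 * B ^ (m + 1) * Real.exp B / (m + 1).factorial < 1 := by
  have hlog : Real.log (η / 180) ≤ -1 := by
    rw [Real.log_le_iff_le_exp (by positivity)]
    have := Real.exp_neg_one_gt_d9
    linarith
  -- For small B a single node suffices: the first term is at most exp(-16B) < 1 - 8B and the second
  -- is at most 8B.
  by_cases hBs : B ≤ 1 / 32
  · refine ⟨0, ?_⟩
    have h1 : (η / 180) ^ (180 * B) ≤ Real.exp (-(16 * B)) := by
      rw [Real.rpow_def_of_pos (by positivity)]
      refine Real.exp_le_exp.2 ?_
      nlinarith
    have h2 : Real.exp (-(16 * B)) ≤ 1 / (1 + 16 * B) := by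
      rw [Real.exp_neg, ← one_div]
      refine one_div_le_one_div_of_le (by positivity) ?_
      linarith [Real.add_one_le_exp (16 * B)]
    have h3 : Real.exp B ≤ 2 := by
      have := Real.exp_le_exp.2 (show B ≤ 1 / 2 by linarith)
      have h4 := Real.exp_one_lt_d9
      have h5 : Real.exp (1 / 2) ^ 2 = Real.exp 1 := by
        rw [← Real.exp_nat_mul]; norm_num
      nlinarith [Real.exp_pos (1 / 2)]
    have h4 : 1 / (1 + 16 * B) < 1 - 8 * B := by
      rw [div_lt_iff₀ (by positivity)]
      nlinarith
    simp only [pow_zero, Nat.factorial_zero, Nat.cast_one, div_one, one_mul, zero_add, pow_one,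
      Nat.factorial_one]
    nlinarith
  · rw [not_le] at hBs
    -- Here n = m + 1. From n ≥ 20B and n! ≥ (n/3)^n the derivative term is at most 4(9/20)^n, and n
    -- ≥ 3 brings it below 1/2. Since B > 1/32, also n ≤ 20B + 4 ≤ 148B; the spare exponent 180B -
    -- 148B = 32B exceeds 1.
    obtain ⟨n, hn⟩ : ∃ n : ℕ, n = ⌈20 * B⌉₊ + 3 := ⟨_, rfl⟩
    have hn1 : 20 * B ≤ n := by
      rw [hn]; push_cast; linarith [Nat.le_ceil (20 * B)]
    have hn2 : (n : ℝ) ≤ 148 * B := by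
      rw [hn]; push_cast; linarith [Nat.ceil_lt_add_one (show 0 ≤ 20 * B by positivity)]
    have hn3 : 3 ≤ n := by omega
    have hn0 : (0 : ℝ) < n := by positivity
    have he1 : Real.exp 1 ≤ 3 := by linarith [Real.exp_one_lt_d9]
    have hfact : (n : ℝ) ^ n / n.factorial ≤ 3 ^ n := by
      calc (n : ℝ) ^ n / n.factorial ≤ Real.exp n := Real.pow_div_factorial_le_exp n hn0.le n
        _ = Real.exp 1 ^ n := by rw [← Real.exp_nat_mul, mul_one]
        _ ≤ 3 ^ n := by gcongr
    refine ⟨n - 1, ?_⟩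
    have hn4 : n - 1 + 1 = n := by omega
    have hcast : ((n - 1 : ℕ) : ℝ) + 1 = n := by exact_mod_cast hn4
    rw [hn4, hcast]
    have hY : 4 * B ^ n * Real.exp B / n.factorial ≤ 1 / 2 := by
      have hexp : Real.exp B ≤ 3 ^ n := by
        calc Real.exp B ≤ Real.exp n := Real.exp_le_exp.2 (by linarith)
          _ = Real.exp 1 ^ n := by rw [← Real.exp_nat_mul, mul_one]
          _ ≤ 3 ^ n := by gcongr
      have hBn : B ^ n ≤ ((1 : ℝ) / 20) ^ n * n ^ n := by
        rw [← mul_pow]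
        gcongr
        linarith
      calc 4 * B ^ n * Real.exp B / n.factorial
          ≤ 4 * (((1 : ℝ) / 20) ^ n * n ^ n) * 3 ^ n / n.factorial := by gcongr
        _ = 4 * ((1 : ℝ) / 20) ^ n * 3 ^ n * ((n : ℝ) ^ n / n.factorial) := by ring
        _ ≤ 4 * ((1 : ℝ) / 20) ^ n * 3 ^ n * 3 ^ n := by gcongr
        _ = 4 * ((9 : ℝ) / 20) ^ n := by
          rw [mul_assoc, mul_assoc, ← mul_pow, ← mul_pow]; norm_num
        _ ≤ 4 * ((9 : ℝ) / 20) ^ 3 := by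
          gcongr ?_ * ?_
          exact pow_le_pow_of_le_one (by norm_num) (by norm_num) hn3
        _ ≤ 1 / 2 := by norm_num
    have hX : (2 * n / η) ^ (n - 1) / (n - 1).factorial ≤ (6 / η) ^ (148 * B) := by
      have e1 : (2 * n / η) ^ (n - 1) / (n - 1).factorial =
          (2 / η) ^ (n - 1) * ((n : ℝ) ^ n / n.factorial) := by
        have e2 : (n.factorial : ℝ) = n * (n - 1).factorial := by
          rw [← hn4, Nat.factorial_succ, hn4]; push_cast; rfl
        have e3 : (n : ℝ) ^ n = n ^ (n - 1) * n := by
          rw [← pow_succ, hn4]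
        rw [e2, e3, mul_div_right_comm, mul_pow]
        field_simp
      have h2η : 1 ≤ 2 / η := by rw [le_div_iff₀ hη]; linarith
      have h6η : 1 ≤ 6 / η := by rw [le_div_iff₀ hη]; linarith
      calc (2 * n / η) ^ (n - 1) / (n - 1).factorial
          ≤ (2 / η) ^ n * 3 ^ n := by
            rw [e1]
            gcongr
            omega
        _ = (6 / η) ^ (n : ℝ) := by
            rw [← mul_pow, Real.rpow_natCast]; congr 1; ring
        _ ≤ (6 / η) ^ (148 * B) := Real.rpow_le_rpow_of_exponent_le h6η hn2
    have hlam : (η / 180) ^ (180 * B) ≤ (η / 6) ^ (148 * B) * (1 / 6) := by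
      have h6 : η / 6 ≤ 1 / 6 := by linarith
      calc (η / 180) ^ (180 * B) ≤ (η / 6) ^ (180 * B) :=
            Real.rpow_le_rpow (by positivity) (by linarith) (by positivity)
        _ = (η / 6) ^ (148 * B) * (η / 6) ^ (32 * B) := by
            rw [← Real.rpow_add (by positivity)]; ring_nf
        _ ≤ (η / 6) ^ (148 * B) * (η / 6) ^ (1 : ℝ) := by
            refine mul_le_mul_of_nonneg_left ?_ (by positivity)
            exact Real.rpow_le_rpow_of_exponent_ge (by positivity) (by linarith) (by linarith)
        _ ≤ (η / 6) ^ (148 * B) * (1 / 6) := by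
            rw [Real.rpow_one]; gcongr
    have hXlam : (2 * n / η) ^ (n - 1) / (n - 1).factorial * (η / 180) ^ (180 * B) ≤ 1 / 6 := by
      calc _ ≤ (6 / η) ^ (148 * B) * ((η / 6) ^ (148 * B) * (1 / 6)) := by gcongr
        _ = 1 / 6 := by
          rw [← mul_assoc, ← Real.mul_rpow (by positivity) (by positivity)]
          have : 6 / η * (η / 6) = 1 := by field_simp
          rw [this, Real.one_rpow, one_mul]
    linarith

/-- If the derivatives of an exponential sum are controlled at a point of `Q`, the sum cannot be
small on a large subset of `Q`. -/
lemma volume_small_lt {ι : Type*} {d : ℕ} (hd : 1 ≤ d) (s : Finset ι) (c : ι → ℂ)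
    (ξ : ι → Fin d → ℝ) {l b : Fin d → ℝ} (hb : ∀ j, 0 < b j)
    (hξ : ∀ k ∈ s, ∀ j, |ξ k j| ≤ b j / 2) {B μ : ℝ} (hB : 0 < B) (hμ : 0 < μ)
    {Q E : Set (Fin d → ℝ)} (hQ : Convex ℝ Q) (hQl : ∀ x ∈ Q, ∀ y ∈ Q, ∀ j, |x j - y j| ≤ l j)
    (hQm : MeasurableSet Q) (hQf : volume Q ≠ ∞) (hQ0 : volume Q ≠ 0)
    (hEm : MeasurableSet E) (hEQ : E ⊆ Q)
    {z : Fin d → ℝ} (hzQ : z ∈ Q)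
    (hz : ∀ N, (avgOp (bernsteinWeight l b) (bernsteinShift b))^[N]
      (fun y => ‖expSum s c ξ y‖ₑ) z ≤ ENNReal.ofReal (4 * B ^ N * μ))
    {x : Fin d → ℝ} (hxQ : x ∈ Q) (hx : μ ≤ ‖expSum s c ξ x‖)
    {ε : ℝ} (hε : 0 < ε) (hε1 : ε ≤ 1)
    (hsmall : ∀ y ∈ E, ‖expSum s c ξ y‖ ≤ (ε ^ 2 / (4 * d) / 180) ^ (180 * B) * μ) :
    volume E < ENNReal.ofReal ε * volume Q := by
  by_contra hcon
  rw [not_lt] at hcon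
  have hd0 : (1 : ℝ) ≤ d := by exact_mod_cast hd
  obtain ⟨v, hvQ, hv⟩ := exists_direction hd hQ hxQ hQm hQf hQ0 hEm hEQ hε hε1 hcon
  set η := ε ^ 2 / (4 * d) with hη
  have hη0 : 0 < η := by positivity
  have hη1 : η ≤ 1 := by
    rw [hη, div_le_one (by positivity)]
    nlinarith
  have hvl : ∀ j, |v j| ≤ l j := fun j => by
    simpa using hQl _ hvQ _ hxQ j
  have hline : ∀ t ∈ Set.Icc (0 : ℝ) 1, x + t • v ∈ Q := by
    intro t ht
    have := hQ.add_smul_mem hxQ hvQ ht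
    exact this
  obtain ⟨m, hm⟩ := remez_constants hB hη0 hη1
  let Φ : ℕ → ℝ → ℂ := fun k t =>
    Complex.I ^ k * expSum s (fun i => c i * ((ξ i ⬝ᵥ v : ℝ) : ℂ) ^ k) ξ (x + t • v)
  have hΦ : ∀ k t, HasDerivAt (Φ k) (Φ (k + 1) t) t := by
    intro k t
    have := (hasDerivAt_expSum_line s (fun i => c i * ((ξ i ⬝ᵥ v : ℝ) : ℂ) ^ k) ξ x v t).const_mul
      (Complex.I ^ k)
    simp only [mul_assoc, ← pow_succ] at this
    rw [← mul_assoc, ← pow_succ] at this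
    exact this
  have hΦ0 : ∀ t, ‖Φ 0 t‖ = ‖expSum s c ξ (x + t • v)‖ := by intro t; simp [Φ]
  have key := norm_le_of_small_on_set hΦ (G := {t : ℝ | t ∈ Set.Icc 0 1 ∧ x + t • v ∈ E})
    (fun t ht => ht.1) hη0 hv (lam := (η / 180) ^ (180 * B) * μ) (by positivity)
    (fun t ht => by rw [hΦ0]; exact hsmall _ ht.2) (M := 4 * B ^ (m + 1) * Real.exp B * μ) m
    (fun t ht => by
      rw [norm_mul, norm_pow, Complex.norm_I, one_pow, one_mul]
      exact norm_expSum_deriv_le s c ξ hb hξ hB.le hμ.le hz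
        (fun j => hQl _ (hline t ht) _ hzQ j) hvl (m + 1))
  rw [hΦ0, zero_smul, add_zero] at key
  -- The factor on the right is less than 1 by the choice of m, contradicting μ > 0.
  have h1 : μ ≤ μ * ((2 * (m + 1) / η) ^ m / m.factorial * (η / 180) ^ (180 * B) +
      4 * B ^ (m + 1) * Real.exp B / (m + 1).factorial) :=
    (hx.trans key).trans (le_of_eq (by ring))
  nlinarith

/-- The local estimate on a good box. -/
lemma setLIntegral_le_of_good {ι : Type*} {d : ℕ} (hd : 1 ≤ d) (s : Finset ι) (c : ι → ℂ)
    (ξ : ι → Fin d → ℝ) {l b : Fin d → ℝ} (hb : ∀ j, 0 < b j)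
    (hξ : ∀ k ∈ s, ∀ j, |ξ k j| ≤ b j / 2) {B p : ℝ} (hB : 0 < B) (hp : 1 ≤ p)
    {Q S : Set (Fin d → ℝ)} (hQ : Convex ℝ Q) (hQl : ∀ x ∈ Q, ∀ y ∈ Q, ∀ j, |x j - y j| ≤ l j)
    (hQm : MeasurableSet Q) (hQf : volume Q ≠ ∞) (hQ0 : volume Q ≠ 0) (hS : MeasurableSet S)
    {δ : ℝ} (hδ : 0 < δ) (hδ1 : δ ≤ 1) (hSQ : ENNReal.ofReal δ * volume Q ≤ volume (S ∩ Q))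
    {z : Fin d → ℝ} (hzQ : z ∈ Q)
    (hz : ∀ N, ((avgOp (bernsteinWeight l b) (bernsteinShift b))^[N]
      (fun y => ‖expSum s c ξ y‖ₑ) z) ^ p ≤
        ENNReal.ofReal (4 * B ^ N) ^ p * ⨍⁻ y in Q, ‖expSum s c ξ y‖ₑ ^ p ∂volume) :
    ENNReal.ofReal (((δ / 2) ^ 2 / (4 * d) / 180) ^ (180 * B)) ^ p * ENNReal.ofReal (δ / 2) *
      ∫⁻ y in Q, ‖expSum s c ξ y‖ₑ ^ p ≤ ∫⁻ y in S ∩ Q, ‖expSum s c ξ y‖ₑ ^ p := by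
  have hp0 : 0 < p := by linarith
  set F := expSum s c ξ with hF
  have hFm : Measurable fun y => ‖F y‖ₑ := (continuous_expSum s c ξ).measurable.enorm
  set I := ∫⁻ y in Q, ‖F y‖ₑ ^ p with hI
  have hIfin : I ≠ ∞ := by
    refine ne_of_lt (lt_of_le_of_lt (b := ∫⁻ _ in Q, ENNReal.ofReal (∑ k ∈ s, ‖c k‖) ^ p)
      (lintegral_mono fun y => ?_) ?_)
    · refine ENNReal.rpow_le_rpow ?_ hp0.le
      rw [← ofReal_norm]
      exact ENNReal.ofReal_le_ofReal (norm_expSum_le s c ξ y)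
    · rw [setLIntegral_const]
      exact ENNReal.mul_lt_top (ENNReal.rpow_lt_top_of_nonneg hp0.le ENNReal.ofReal_ne_top)
        hQf.lt_top
  by_cases hI0 : I = 0
  · rw [hI0, mul_zero]; exact zero_le
  rw [setLAverage_eq, ← hI] at hz
  set a := I / volume Q with ha
  have ha0 : a ≠ 0 := (ENNReal.div_pos hI0 hQf).ne'
  have hafin : a ≠ ∞ := (ENNReal.div_lt_top hIfin hQ0).ne
  have haI : a * volume Q = I := ENNReal.div_mul_cancel hQ0 hQf
  -- μ is the L^p mean of F over Q; a point where |F| is at least its mean starts the segment.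
  set μ := (a ^ p⁻¹).toReal with hμ
  have hroot : a ^ p⁻¹ ≠ ∞ := ENNReal.rpow_ne_top_of_nonneg (by positivity) hafin
  have hμa : ENNReal.ofReal μ = a ^ p⁻¹ := ENNReal.ofReal_toReal hroot
  have hμp : ENNReal.ofReal μ ^ p = a := by
    rw [hμa, ← ENNReal.rpow_mul, inv_mul_cancel₀ hp0.ne', ENNReal.rpow_one]
  have hμ0 : 0 < μ := by
    refine ENNReal.toReal_pos (fun h0 => ha0 ?_) hroot
    rw [← hμp, hμa, h0, ENNReal.zero_rpow_of_pos hp0]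
  obtain ⟨x, hxQ, hx⟩ := exists_setLAverage_le hQ0 hQm.nullMeasurableSet
    (f := fun y => ‖F y‖ₑ ^ p) (by rw [← hI]; exact hIfin)
  rw [setLAverage_eq, ← hI, ← ha, ← hμp, ENNReal.rpow_le_rpow_iff hp0, ← ofReal_norm,
    ENNReal.ofReal_le_ofReal_iff (norm_nonneg _)] at hx
  set lam := ((δ / 2) ^ 2 / (4 * d) / 180) ^ (180 * B) with hlam
  have hsmall := volume_small_lt hd s c ξ hb hξ hB hμ0 hQ hQl hQm hQf hQ0
    (E := (S ∩ Q) ∩ {y | ‖F y‖ ≤ lam * μ})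
    ((hS.inter hQm).inter ((continuous_expSum s c ξ).norm.measurable measurableSet_Iic))
    (fun y hy => hy.1.2) hzQ
    (fun N => by
      have := hz N
      rw [← hμp, ← ENNReal.mul_rpow_of_nonneg _ _ hp0.le, ENNReal.rpow_le_rpow_iff hp0,
        ← ENNReal.ofReal_mul (by positivity)] at this
      exact this) hxQ hx (ε := δ / 2) (by positivity) (by linarith) (fun y hy => hy.2)
  -- The set where F is small takes less than δ/2 of Q, so at least half of the guaranteed
  -- proportion δ remains.
  have hbig : ENNReal.ofReal (δ / 2) * volume Q ≤
      volume ((S ∩ Q) ∩ {y | lam * μ < ‖F y‖}) := by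
    have h1 : volume (S ∩ Q) ≤ volume ((S ∩ Q) ∩ {y | ‖F y‖ ≤ lam * μ}) +
        volume ((S ∩ Q) ∩ {y | lam * μ < ‖F y‖}) := by
      refine (measure_mono fun y hy => ?_).trans (measure_union_le _ _)
      rcases le_or_gt ‖F y‖ (lam * μ) with h | h
      · exact Or.inl ⟨hy, h⟩
      · exact Or.inr ⟨hy, h⟩
    have h2 : ENNReal.ofReal (δ / 2) * volume Q + ENNReal.ofReal (δ / 2) * volume Q ≤
        ENNReal.ofReal (δ / 2) * volume Q + volume ((S ∩ Q) ∩ {y | lam * μ < ‖F y‖}) := by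
      rw [← add_mul, ← ENNReal.ofReal_add (by positivity) (by positivity), add_halves]
      refine hSQ.trans (h1.trans ?_)
      gcongr
    exact (ENNReal.add_le_add_iff_left (ENNReal.mul_ne_top ENNReal.ofReal_ne_top hQf)).1 h2
  calc ENNReal.ofReal lam ^ p * ENNReal.ofReal (δ / 2) * I
      = ENNReal.ofReal (lam * μ) ^ p * (ENNReal.ofReal (δ / 2) * volume Q) := by
        rw [← haI, ← hμp, ENNReal.ofReal_mul (by positivity), ENNReal.mul_rpow_of_nonneg _ _ hp0.le]
        ring
    _ ≤ ENNReal.ofReal (lam * μ) ^ p * volume ((S ∩ Q) ∩ {y | lam * μ < ‖F y‖}) := by gcongr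
    _ ≤ ∫⁻ y in (S ∩ Q) ∩ {y | lam * μ < ‖F y‖}, ‖F y‖ₑ ^ p := by
        rw [← setLIntegral_const]
        refine setLIntegral_mono' ((hS.inter hQm).inter
          ((continuous_expSum s c ξ).norm.measurable measurableSet_Ioi)) fun y hy => ?_
        refine ENNReal.rpow_le_rpow ?_ hp0.le
        rw [← ofReal_norm]
        exact ENNReal.ofReal_le_ofReal hy.2.le
    _ ≤ ∫⁻ y in S ∩ Q, ‖F y‖ₑ ^ p := lintegral_mono_set Set.inter_subset_left

/-! ### Grid boxes and the good/bad decomposition -/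

/-- The box with lower corner `(m j * l j)_j` and side lengths `l`. -/
def gridBox {d : ℕ} (l : Fin d → ℝ) (m : Fin d → ℕ) : Set (Fin d → ℝ) :=
  Set.univ.pi fun j => Set.Ico (m j * l j) ((m j + 1) * l j)

lemma measurableSet_gridBox {d : ℕ} (l : Fin d → ℝ) (m : Fin d → ℕ) :
    MeasurableSet (gridBox l m) := MeasurableSet.univ_pi fun _ => measurableSet_Ico

lemma convex_gridBox {d : ℕ} (l : Fin d → ℝ) (m : Fin d → ℕ) : Convex ℝ (gridBox l m) :=
  convex_pi fun _ _ => convex_Ico _ _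

lemma volume_gridBox {d : ℕ} (l : Fin d → ℝ) (m : Fin d → ℕ) :
    volume (gridBox l m) = ∏ j, ENNReal.ofReal (l j) := by
  rw [gridBox, volume_pi_pi]
  refine Finset.prod_congr rfl fun j _ => ?_
  rw [Real.volume_Ico]
  congr 1
  ring

lemma abs_sub_le_of_mem_gridBox {d : ℕ} {l : Fin d → ℝ} {m : Fin d → ℕ} {x y : Fin d → ℝ}
    (hx : x ∈ gridBox l m) (hy : y ∈ gridBox l m) (j : Fin d) : |x j - y j| ≤ l j := by
  have h1 := hx j (Set.mem_univ j)
  have h2 := hy j (Set.mem_univ j)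
  rw [Set.mem_Ico] at h1 h2
  rw [abs_le]
  constructor <;> nlinarith

lemma mem_gridBox_iff {d : ℕ} {l : Fin d → ℝ} (hl : ∀ j, 0 < l j) {m : Fin d → ℕ} {x : Fin d → ℝ}
    (hx : ∀ j, 0 ≤ x j) : x ∈ gridBox l m ↔ ∀ j, ⌊x j / l j⌋₊ = m j := by
  simp only [gridBox, Set.mem_pi, Set.mem_univ, true_imp_iff]
  refine forall_congr' fun j => ?_
  rw [Nat.floor_eq_iff (div_nonneg (hx j) (hl j).le), le_div_iff₀ (hl j), div_lt_iff₀ (hl j),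
    Set.mem_Ico]

lemma halfOpenCell_eq_biUnion_gridBox {d : ℕ} {τ : ℝ} (hτ : 0 < τ) {N : Fin d → ℕ}
    (hN : ∀ j, 0 < N j) :
    halfOpenCell d τ = ⋃ m ∈ Fintype.piFinset fun j => Finset.range (N j),
      gridBox (fun j => τ / N j) m := by
  have hl : ∀ j, 0 < τ / N j := fun j => div_pos hτ (by exact_mod_cast hN j)
  ext x
  simp only [Set.mem_iUnion, Fintype.mem_piFinset, Finset.mem_range, exists_prop]
  constructor
  · intro hx
    have hx0 : ∀ j, 0 ≤ x j := fun j => (hx j (Set.mem_univ j)).1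
    refine ⟨fun j => ⌊x j / (τ / N j)⌋₊, fun j => ?_, (mem_gridBox_iff hl hx0).2 fun j => rfl⟩
    rw [Nat.floor_lt (div_nonneg (hx0 j) (hl j).le), div_lt_iff₀ (hl j),
      mul_div_cancel₀ _ (by exact_mod_cast (hN j).ne')]
    exact (hx j (Set.mem_univ j)).2
  · rintro ⟨m, hm, hx⟩ j hj
    have h1 := hx j hj
    refine ⟨le_trans (mul_nonneg (Nat.cast_nonneg _) (hl j).le) h1.1, h1.2.trans_le ?_⟩
    have h2 : ((m j : ℝ) + 1) ≤ N j := by exact_mod_cast hm j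
    calc ((m j : ℝ) + 1) * (τ / N j) ≤ N j * (τ / N j) := by
          gcongr
      _ = τ := mul_div_cancel₀ _ (by exact_mod_cast (hN j).ne')

lemma pairwiseDisjoint_gridBox {d : ℕ} {l : Fin d → ℝ} (hl : ∀ j, 0 < l j)
    (t : Set (Fin d → ℕ)) : t.PairwiseDisjoint (gridBox l) := by
  intro m _ m' _ hmm'
  rw [Function.onFun, Set.disjoint_left]
  intro x hx hx'
  have hx0 : ∀ j, 0 ≤ x j := fun j =>
    le_trans (mul_nonneg (Nat.cast_nonneg _) (hl j).le) (hx j (Set.mem_univ j)).1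
  apply hmm'
  ext j
  rw [← (mem_gridBox_iff hl hx0).1 hx j, (mem_gridBox_iff hl hx0).1 hx' j]

/-- The N-th term equals (4^(-N-1))^p, hence is at most 4^(-N-1) as p ≥ 1; the sum is at most 1/3.
The thresholds 4(4A)^N are chosen for this summability, uniformly in p. -/
lemma tsum_inv_mul_pow_le {A p : ℝ} (hA : 0 < A) (hp : 1 ≤ p) :
    ∑' N : ℕ, (ENNReal.ofReal (4 * (4 * A) ^ N) ^ p)⁻¹ * (ENNReal.ofReal A ^ p) ^ N ≤ 2⁻¹ := by
  have hp0 : 0 < p := by linarith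
  have hterm : ∀ N : ℕ, (ENNReal.ofReal (4 * (4 * A) ^ N) ^ p)⁻¹ * (ENNReal.ofReal A ^ p) ^ N ≤
      ENNReal.ofReal (1 / 4 * (1 / 4) ^ N) := by
    intro N
    have h1 : (ENNReal.ofReal (4 * (4 * A) ^ N) ^ p)⁻¹ * (ENNReal.ofReal A ^ p) ^ N =
        ENNReal.ofReal (1 / 4 * (1 / 4) ^ N) ^ p := by
      rw [← ENNReal.inv_rpow, ← ENNReal.ofReal_inv_of_pos (by positivity), ← ENNReal.rpow_mul_natCast,
        mul_comm p, ENNReal.rpow_natCast_mul, ← ENNReal.ofReal_pow hA.le,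
        ← ENNReal.mul_rpow_of_nonneg _ _ hp0.le, ← ENNReal.ofReal_mul (by positivity)]
      congr 2
      rw [mul_pow, mul_inv, mul_inv, one_div, inv_pow]
      field_simp
    rw [h1]
    have h2 : ENNReal.ofReal (1 / 4 * (1 / 4) ^ N) ≤ 1 := by
      rw [ENNReal.ofReal_le_one]
      have : ((1 : ℝ) / 4) ^ N ≤ 1 := pow_le_one₀ (by norm_num) (by norm_num)
      linarith
    calc _ ≤ ENNReal.ofReal (1 / 4 * (1 / 4) ^ N) ^ (1 : ℝ) :=
          ENNReal.rpow_le_rpow_of_exponent_ge h2 hp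
      _ = _ := ENNReal.rpow_one _
  refine (ENNReal.tsum_le_tsum hterm).trans ?_
  have hs := (hasSum_geometric_of_lt_one (r := (1 : ℝ) / 4) (by norm_num) (by norm_num)).mul_left
    (1 / 4)
  rw [← ENNReal.ofReal_tsum_of_nonneg (fun N => by positivity) hs.summable, hs.tsum_eq]
  rw [← ENNReal.ofReal_ofNat, ← ENNReal.ofReal_inv_of_pos (by norm_num)]
  exact ENNReal.ofReal_le_ofReal (by norm_num)

/-- The boxes on which some average is large carry at most half of the mass. -/
lemma setLIntegral_le_two_mul_sum_good {ι E : Type*} [MeasurableSpace E] {ν : Measure E}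
    (T : Finset ι) (Q : ι → Set E) (hQm : ∀ i, MeasurableSet (Q i)) (hQf : ∀ i, ν (Q i) ≠ ∞)
    (hQ0 : ∀ i, ν (Q i) ≠ 0) (hQd : (T : Set ι).PairwiseDisjoint Q) {D : Set E}
    (hD : D = ⋃ i ∈ T, Q i) (V : ℕ → E → ℝ≥0∞) (hV : ∀ N, Measurable (V N)) {A p : ℝ} (hA : 0 < A)
    (hp : 1 ≤ p) (hVle : ∀ N, ∫⁻ x in D, V N x ^ p ∂ν ≤
      (ENNReal.ofReal A ^ p) ^ N * ∫⁻ x in D, V 0 x ^ p ∂ν)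
    (hfin : ∫⁻ x in D, V 0 x ^ p ∂ν ≠ ∞) (G : Set ι) [DecidablePred (· ∈ G)]
    (hG : ∀ i, i ∉ G → ∀ z ∈ Q i, ∃ N, ENNReal.ofReal (4 * (4 * A) ^ N) ^ p *
      ⨍⁻ x in Q i, V 0 x ^ p ∂ν ≤ V N z ^ p) :
    ∫⁻ x in D, V 0 x ^ p ∂ν ≤ 2 * ∑ i ∈ T with i ∈ G, ∫⁻ x in Q i, V 0 x ^ p ∂ν := by
  have hp0 : 0 < p := by linarith
  set κ : ℕ → ℝ≥0∞ := fun N => ENNReal.ofReal (4 * (4 * A) ^ N) ^ p with hκ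
  have hκ0 : ∀ N, κ N ≠ 0 := fun N => by
    have : 0 < ENNReal.ofReal (4 * (4 * A) ^ N) := ENNReal.ofReal_pos.2 (by positivity)
    exact (ENNReal.rpow_pos this ENNReal.ofReal_ne_top).ne'
  have hκt : ∀ N, κ N ≠ ∞ := fun N =>
    ENNReal.rpow_ne_top_of_nonneg hp0.le ENNReal.ofReal_ne_top
  -- One function tests all orders N at once: at every point of a bad box some term alone reaches
  -- the mean over the box, while the total integral of Ψ is at most half the mass.
  set Ψ : E → ℝ≥0∞ := fun x => ∑' N, (κ N)⁻¹ * V N x ^ p with hΨ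
  have hΨint : ∫⁻ x in D, Ψ x ∂ν ≤ 2⁻¹ * ∫⁻ x in D, V 0 x ^ p ∂ν := by
    rw [hΨ, lintegral_tsum fun N => (((hV N).pow_const p).const_mul _).aemeasurable]
    calc ∑' N, ∫⁻ x in D, (κ N)⁻¹ * V N x ^ p ∂ν
        ≤ ∑' N, (κ N)⁻¹ * (ENNReal.ofReal A ^ p) ^ N * ∫⁻ x in D, V 0 x ^ p ∂ν := by
          refine ENNReal.tsum_le_tsum fun N => ?_
          rw [lintegral_const_mul _ ((hV N).pow_const p), mul_assoc]
          exact mul_le_mul' le_rfl (hVle N)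
      _ ≤ 2⁻¹ * ∫⁻ x in D, V 0 x ^ p ∂ν := by
          rw [ENNReal.tsum_mul_right]
          exact mul_le_mul' (tsum_inv_mul_pow_le hA hp) le_rfl
  have hbad : ∀ i, i ∉ G → ∫⁻ x in Q i, V 0 x ^ p ∂ν ≤ ∫⁻ x in Q i, Ψ x ∂ν := by
    intro i hi
    have h1 : ∀ z ∈ Q i, ⨍⁻ x in Q i, V 0 x ^ p ∂ν ≤ Ψ z := by
      intro z hz
      obtain ⟨N, hN⟩ := hG i hi z hz
      refine le_trans ?_ (ENNReal.le_tsum N)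
      rw [mul_comm, ← div_eq_mul_inv, ENNReal.le_div_iff_mul_le (Or.inl (hκ0 N)) (Or.inl (hκt N)), mul_comm]
      exact hN
    calc ∫⁻ x in Q i, V 0 x ^ p ∂ν = (⨍⁻ x in Q i, V 0 x ^ p ∂ν) * ν (Q i) := by
          rw [setLAverage_eq, ENNReal.div_mul_cancel (hQ0 i) (hQf i)]
      _ = ∫⁻ _ in Q i, (⨍⁻ x in Q i, V 0 x ^ p ∂ν) ∂ν := by rw [setLIntegral_const]
      _ ≤ _ := setLIntegral_mono' (hQm i) h1
  have hsplit : ∀ f : E → ℝ≥0∞, ∫⁻ x in D, f x ∂ν = ∑ i ∈ T, ∫⁻ x in Q i, f x ∂ν := by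
    intro f
    rw [hD, lintegral_biUnion_finset hQd (fun i _ => hQm i)]
  set I := ∫⁻ x in D, V 0 x ^ p ∂ν with hI
  have hle : I ≤ ∑ i ∈ T with i ∈ G, ∫⁻ x in Q i, V 0 x ^ p ∂ν + 2⁻¹ * I := by
    calc I = ∑ i ∈ T with i ∈ G, ∫⁻ x in Q i, V 0 x ^ p ∂ν +
          ∑ i ∈ T with ¬ i ∈ G, ∫⁻ x in Q i, V 0 x ^ p ∂ν := by
          rw [hI, hsplit, Finset.sum_filter_add_sum_filter_not]
      _ ≤ _ := by
          refine add_le_add le_rfl (le_trans ?_ hΨint)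
          rw [hsplit]
          calc ∑ i ∈ T with ¬ i ∈ G, ∫⁻ x in Q i, V 0 x ^ p ∂ν
              ≤ ∑ i ∈ T with ¬ i ∈ G, ∫⁻ x in Q i, Ψ x ∂ν :=
                Finset.sum_le_sum fun i hi => hbad i (Finset.mem_filter.1 hi).2
            _ ≤ _ := Finset.sum_le_sum_of_subset (Finset.filter_subset _ _)
  have hhalf : 2⁻¹ * I + 2⁻¹ * I = I := by
    rw [← add_mul, ENNReal.inv_two_add_inv_two, one_mul]
  have h2 : 2⁻¹ * I ≤ ∑ i ∈ T with i ∈ G, ∫⁻ x in Q i, V 0 x ^ p ∂ν := by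
    refine (ENNReal.add_le_add_iff_right (ENNReal.mul_ne_top (by simp) hfin) (a := 2⁻¹ * I)).1 ?_
    rwa [hhalf]
  calc I = 2 * (2⁻¹ * I) := by
        rw [← mul_assoc, ENNReal.mul_inv_cancel (by norm_num) (by norm_num), one_mul]
    _ ≤ _ := by gcongr

lemma centredBox_eq_Icc {d : ℕ} (x s : Fin d → ℝ) :
    centredBox x s = Set.Icc (fun j => x j - s j / 2) (fun j => x j + s j / 2) := by
  ext y
  simp [centredBox, Pi.le_def, forall_and]

lemma volume_centredBox {d : ℕ} (x s : Fin d → ℝ) :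
    volume (centredBox x s) = ∏ j, ENNReal.ofReal (s j) := by
  rw [centredBox_eq_Icc, Real.volume_Icc_pi]
  refine Finset.prod_congr rfl fun j _ => ?_
  congr 1
  ring

/-- Thickness passes to grid boxes with slightly larger sides. -/
lemma IsThickSet.volume_inter_gridBox {d : ℕ} {γ : ℝ} {a l : Fin d → ℝ} {S : Set (Fin d → ℝ)}
    (hS : IsThickSet γ a S) (hal : ∀ j, a j ≤ l j) (hla : ∀ j, l j ≤ 2 * a j) (m : Fin d → ℕ) :
    ENNReal.ofReal (γ / 2 ^ d) * volume (gridBox l m) ≤ volume (S ∩ gridBox l m) := by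
  have hcl : (gridBox l m : Set (Fin d → ℝ)) =ᵐ[volume]
      Set.Icc (fun j => m j * l j) (fun j => (m j + 1) * l j) := Measure.univ_pi_Ico_ae_eq_Icc
  have h1 : volume (S ∩ gridBox l m) =
      volume (S ∩ Set.Icc (fun j => m j * l j) (fun j => (m j + 1) * l j)) :=
    measure_congr (ae_eq_set_inter Filter.EventuallyEq.rfl hcl)
  -- The grid box contains, up to its boundary, a box of sides a, whose volume is at least 2^(-d)
  -- times its own because l ≤ 2a.
  have hsub : centredBox (fun j => m j * l j + a j / 2) a ⊆
      Set.Icc (fun j => m j * l j) (fun j => (m j + 1) * l j) := by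
    rw [centredBox_eq_Icc]
    refine Set.Icc_subset_Icc (fun j => by simp) (fun j => ?_)
    have := hal j
    simp only
    linarith
  rw [h1, volume_gridBox]
  refine le_trans ?_ ((hS.density _).trans (measure_mono (Set.inter_subset_inter_right S hsub)))
  rw [volume_centredBox]
  calc ENNReal.ofReal (γ / 2 ^ d) * ∏ j, ENNReal.ofReal (l j)
      ≤ ENNReal.ofReal (γ / 2 ^ d) * ∏ j, ENNReal.ofReal (2 * a j) := by
        refine mul_le_mul' le_rfl (Finset.prod_le_prod' fun j _ => ?_)
        exact ENNReal.ofReal_le_ofReal (hla j)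
    _ = ENNReal.ofReal γ * ∏ j, ENNReal.ofReal (a j) := by
        have h2 : ∀ j, ENNReal.ofReal (2 * a j) = 2 * ENNReal.ofReal (a j) := fun j => by
          rw [ENNReal.ofReal_mul (by norm_num), ENNReal.ofReal_ofNat]
        simp only [h2, Finset.prod_mul_distrib, Finset.prod_const, Finset.card_univ,
          Fintype.card_fin]
        rw [← mul_assoc, ENNReal.ofReal_div_of_pos (by positivity),
          ENNReal.ofReal_pow (by norm_num), ENNReal.ofReal_ofNat,
          ENNReal.div_mul_cancel (by simp) (by simp)]

/-- Take N = ⌊τ/a⌋; for t ≥ 1 the quotient t/⌊t⌋ lies between 1 and 2. -/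
lemma exists_grid_number {τ a : ℝ} (ha : 0 < a) (haτ : a ≤ τ) :
    ∃ N : ℕ, 0 < N ∧ a ≤ τ / N ∧ τ / N ≤ 2 * a := by
  have h1 : 1 ≤ τ / a := by rwa [le_div_iff₀ ha, one_mul]
  have hN : 0 < ⌊τ / a⌋₊ := Nat.floor_pos.2 h1
  have hN' : (1 : ℝ) ≤ ⌊τ / a⌋₊ := by exact_mod_cast hN
  have h2 := Nat.floor_le (zero_le_one.trans h1)
  have h3 := Nat.lt_floor_add_one (τ / a)
  rw [le_div_iff₀ ha] at h2
  rw [div_lt_iff₀ ha] at h3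
  refine ⟨⌊τ / a⌋₊, hN, ?_, ?_⟩
  · rw [le_div_iff₀ (by positivity)]; linarith
  · rw [div_le_iff₀ (by positivity)]; nlinarith

/-! ### Summing over good boxes -/

/-- The Logvinenko-Sereda inequality for exponential sums of periodic modulus, `p < ∞`. -/
lemma expSum_setLIntegral_le {ι : Type*} {d : ℕ} (hd : 1 ≤ d) (s : Finset ι) (c : ι → ℂ)
    (ξ : ι → Fin d → ℝ) {a b : Fin d → ℝ} (hb : ∀ j, 0 < b j)
    (hξ : ∀ k ∈ s, ∀ j, |ξ k j| ≤ b j / 2) {τ : ℝ} (hτ : 0 < τ) (haτ : ∀ j, a j ≤ τ)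
    (hper : CoordPeriodic τ fun x => ‖expSum s c ξ x‖ₑ) {p γ : ℝ} (hp : 1 ≤ p)
    {S : Set (Fin d → ℝ)} (hS : IsThickSet γ a S) (hSm : MeasurableSet S) :
    ENNReal.ofReal (((γ / 2 ^ d / 2) ^ 2 / (4 * d) / 180) ^ (1440 * ∑ j, a j * b j)) ^ p *
      ENNReal.ofReal (γ / 2 ^ d / 2) * ∫⁻ x in halfOpenCell d τ, ‖expSum s c ξ x‖ₑ ^ p ≤
      2 * ∫⁻ x in S ∩ halfOpenCell d τ, ‖expSum s c ξ x‖ₑ ^ p := by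
  classical
  have hp0 : 0 < p := by linarith
  choose N hN0 hN1 hN2 using fun j => exists_grid_number (hS.side_pos j) (haτ j)
  set l : Fin d → ℝ := fun j => τ / N j with hl
  have hl0 : ∀ j, 0 < l j := fun j => (hS.side_pos j).trans_le (hN1 j)
  -- The total weight is at most l·b, and l ≤ 2a.
  set A := 2 * ∑ j, a j * b j with hA
  have hA0 : 0 < A := by
    refine mul_pos two_pos (Finset.sum_pos (fun j _ => mul_pos (hS.side_pos j) (hb j)) ?_)
    exact ⟨⟨0, hd⟩, Finset.mem_univ _⟩
  have hW : ∑' i, bernsteinWeight l b i ≤ ENNReal.ofReal A := by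
    refine (tsum_bernsteinWeight_le (fun j => (hl0 j).le) hb).trans (ENNReal.ofReal_le_ofReal ?_)
    rw [hA, Finset.mul_sum]
    refine Finset.sum_le_sum fun j _ => ?_
    rw [← mul_assoc]
    exact mul_le_mul_of_nonneg_right (hN2 j) (hb j).le
  set u : (Fin d → ℝ) → ℝ≥0∞ := fun x => ‖expSum s c ξ x‖ₑ with hu
  have hum : Measurable u := (continuous_expSum s c ξ).measurable.enorm
  set V : ℕ → (Fin d → ℝ) → ℝ≥0∞ :=
    fun N => (avgOp (bernsteinWeight l b) (bernsteinShift b))^[N] u with hV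
  have hit := fun N => hper.iterate_avgOp hτ hum (bernsteinWeight l b) (bernsteinShift b) hp N
  have hQf : ∀ m, volume (gridBox l m) ≠ ∞ := fun m => by
    rw [volume_gridBox]
    exact ENNReal.prod_ne_top fun j _ => ENNReal.ofReal_ne_top
  have hQ0 : ∀ m, volume (gridBox l m) ≠ 0 := fun m => by
    rw [volume_gridBox]
    exact Finset.prod_ne_zero_iff.2 fun j _ => (ENNReal.ofReal_pos.2 (hl0 j)).ne'
  have hfin : ∫⁻ x in halfOpenCell d τ, V 0 x ^ p ≠ ∞ := by
    refine ne_of_lt (lt_of_le_of_lt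
      (b := ∫⁻ _ in halfOpenCell d τ, ENNReal.ofReal (∑ k ∈ s, ‖c k‖) ^ p)
      (lintegral_mono fun y => ?_) ?_)
    · refine ENNReal.rpow_le_rpow ?_ hp0.le
      simp only [hV, hu, Function.iterate_zero, id_eq]
      rw [← ofReal_norm]
      exact ENNReal.ofReal_le_ofReal (norm_expSum_le s c ξ y)
    · rw [setLIntegral_const]
      refine ENNReal.mul_lt_top (ENNReal.rpow_lt_top_of_nonneg hp0.le ENNReal.ofReal_ne_top) ?_
      rw [halfOpenCell, volume_pi_pi]
      exact ENNReal.prod_lt_top fun j _ => by simp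
  set T := Fintype.piFinset fun j => Finset.range (N j) with hT
  have hcell : halfOpenCell d τ = ⋃ m ∈ T, gridBox l m := halfOpenCell_eq_biUnion_gridBox hτ hN0
  -- One controlled point is enough for a good box; in a bad box every point violates some
  -- threshold.
  let G : Set (Fin d → ℕ) := {m | ∃ z ∈ gridBox l m, ∀ N, V N z ^ p ≤
    ENNReal.ofReal (4 * (4 * A) ^ N) ^ p * ⨍⁻ x in gridBox l m, V 0 x ^ p ∂volume}
  have hhalf := setLIntegral_le_two_mul_sum_good T (gridBox l) (measurableSet_gridBox l) hQf hQ0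
    (pairwiseDisjoint_gridBox hl0 _) hcell V (fun N => (hit N).2.1) hA0 hp
    (fun N => (hit N).2.2.trans (by
      refine mul_le_mul' ?_ le_rfl
      gcongr)) hfin G (by
      intro m hm z hz
      by_contra hcon
      push Not at hcon
      exact hm ⟨z, hz, fun N => (hcon N).le⟩)
  have hγ := hS.gamma_pos
  have hδ1 : γ / 2 ^ d ≤ 1 := by
    rw [div_le_one (by positivity)]
    exact hS.gamma_le_one.trans (one_le_pow₀ (by norm_num))
  set C := ENNReal.ofReal (((γ / 2 ^ d / 2) ^ 2 / (4 * d) / 180) ^ (1440 * ∑ j, a j * b j)) ^ p *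
      ENNReal.ofReal (γ / 2 ^ d / 2) with hC
  have hgood : ∀ m ∈ G, C * ∫⁻ x in gridBox l m, u x ^ p ≤
      ∫⁻ x in S ∩ gridBox l m, u x ^ p := by
    rintro m ⟨z, hz, hzN⟩
    have := setLIntegral_le_of_good hd s c ξ hb hξ (B := 4 * A) (by positivity) hp
      (convex_gridBox l m) (fun x hx y hy j => abs_sub_le_of_mem_gridBox hx hy j)
      (measurableSet_gridBox l m) (hQf m) (hQ0 m) hSm (δ := γ / 2 ^ d) (by positivity) hδ1
      (hS.volume_inter_gridBox hN1 hN2 m) hz hzN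
    -- The growth rate of the thresholds is B = 4A = 8a·b, so the exponent 180B becomes 1440a·b.
    have hexp : 180 * (4 * A) = 1440 * ∑ j, a j * b j := by rw [hA]; ring
    rwa [hexp] at this
  calc C * ∫⁻ x in halfOpenCell d τ, u x ^ p
      ≤ C * (2 * ∑ m ∈ T with m ∈ G, ∫⁻ x in gridBox l m, u x ^ p) := mul_le_mul' le_rfl hhalf
    _ = 2 * ∑ m ∈ T with m ∈ G, C * ∫⁻ x in gridBox l m, u x ^ p := by
        rw [mul_left_comm, Finset.mul_sum]
    _ ≤ 2 * ∑ m ∈ T with m ∈ G, ∫⁻ x in S ∩ gridBox l m, u x ^ p := by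
        refine mul_le_mul' le_rfl (Finset.sum_le_sum fun m hm => ?_)
        exact hgood m (Finset.mem_filter.1 hm).2
    _ ≤ 2 * ∑ m ∈ T, ∫⁻ x in S ∩ gridBox l m, u x ^ p :=
        mul_le_mul' le_rfl (Finset.sum_le_sum_of_subset (Finset.filter_subset _ _))
    _ = 2 * ∫⁻ x in S ∩ halfOpenCell d τ, u x ^ p := by
        rw [hcell, Set.inter_iUnion₂, lintegral_biUnion_finset]
        · exact fun m hm m' hm' h => ((pairwiseDisjoint_gridBox hl0 (T : Set _)) hm hm' h).mono
            Set.inter_subset_right Set.inter_subset_right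
        · exact fun m _ => hSm.inter (measurableSet_gridBox l m)

/-! ### Fourier uniqueness and trigonometric polynomials -/

/-- An integrable function annihilating a dense subspace of the continuous functions vanishes. -/
lemma ae_eq_zero_of_integral_mul_span_eq_zero {X : Type*} [PseudoMetricSpace X] [CompactSpace X]
    [MeasurableSpace X] [BorelSpace X] {μ : Measure X} {g : X → ℂ}
    (hg : Integrable g μ) {A : Set C(X, ℂ)} (hA : (Submodule.span ℂ A).topologicalClosure = ⊤)
    (h : ∀ φ ∈ A, ∫ x, φ x * g x ∂μ = 0) : g =ᵐ[μ] 0 := by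
  have hint : ∀ φ : C(X, ℂ), Integrable (fun x => φ x * g x) μ := fun φ =>
    hg.bdd_mul φ.continuous.aestronglyMeasurable (c := ‖φ‖)
      (Filter.Eventually.of_forall fun x => φ.norm_coe_le_norm x)
  let Λ : C(X, ℂ) →L[ℂ] ℂ := LinearMap.mkContinuous
    { toFun := fun φ => ∫ x, φ x * g x ∂μ
      map_add' := fun φ ψ => by
        rw [← integral_add (hint φ) (hint ψ)]
        simp [add_mul]
      map_smul' := fun a φ => by
        simp [mul_assoc, integral_const_mul] } (∫ x, ‖g x‖ ∂μ) (by
    intro φ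
    simp only [LinearMap.coe_mk, AddHom.coe_mk]
    rw [mul_comm, ← integral_const_mul]
    refine norm_integral_le_of_norm_le (hg.norm.const_mul _) (Filter.Eventually.of_forall fun x => ?_)
    rw [norm_mul]
    gcongr
    exact φ.norm_coe_le_norm x)
  have hΛ : ∀ φ : C(X, ℂ), ∫ x, φ x * g x ∂μ = 0 := by
    have h1 : Submodule.span ℂ A ≤ LinearMap.ker Λ.toLinearMap :=
      Submodule.span_le.2 fun φ hφ => h φ hφ
    have h2 : (Submodule.span ℂ A).topologicalClosure ≤ LinearMap.ker Λ.toLinearMap :=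
      Submodule.topologicalClosure_minimal _ h1 Λ.isClosed_ker
    rw [hA] at h2
    intro φ
    exact h2 (Submodule.mem_top (x := φ))
  -- Closed sets suffice, and their indicators are bounded pointwise limits of continuous thickened
  -- indicators.
  refine ae_eq_zero_of_forall_setIntegral_isClosed_eq_zero hg fun s hs => ?_
  have hδ : ∀ n : ℕ, (0 : ℝ) < 1 / (n + 1) := fun n => by positivity
  have hlim := thickenedIndicator_tendsto_indicator_closure hδ
    tendsto_one_div_add_atTop_nhds_zero_nat s
  rw [hs.closure_eq, tendsto_pi_nhds] at hlim
  have hDCT : Filter.Tendsto (fun n : ℕ => ∫ x, (((thickenedIndicator (hδ n) s x : NNReal) : ℝ) : ℂ)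
      * g x ∂μ) Filter.atTop (nhds (∫ x, s.indicator g x ∂μ)) := by
    refine tendsto_integral_of_dominated_convergence (fun x => ‖g x‖) ?_ hg.norm ?_ ?_
    · intro n
      refine AEStronglyMeasurable.mul (Continuous.aestronglyMeasurable ?_) hg.1
      exact Complex.continuous_ofReal.comp (NNReal.continuous_coe.comp
        (thickenedIndicator (hδ n) s).continuous)
    · intro n
      refine Filter.Eventually.of_forall fun x => ?_
      rw [norm_mul, Complex.norm_real, NNReal.norm_eq]
      exact mul_le_of_le_one_left (norm_nonneg _)
        (by exact_mod_cast thickenedIndicator_le_one (hδ n) s x)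
    · refine Filter.Eventually.of_forall fun x => ?_
      have h1 := ((Complex.continuous_ofReal.comp NNReal.continuous_coe).tendsto _).comp (hlim x)
      have h2 := h1.mul_const (g x)
      convert! h2 using 2
      by_cases hx : x ∈ s <;> simp [hx]
  have hzero : ∀ n : ℕ, ∫ x, (((thickenedIndicator (hδ n) s x : NNReal) : ℝ) : ℂ) * g x ∂μ = 0 := by
    intro n
    exact hΛ ⟨fun x => (((thickenedIndicator (hδ n) s x : NNReal) : ℝ) : ℂ),
      Complex.continuous_ofReal.comp (NNReal.continuous_coe.comp
        (thickenedIndicator (hδ n) s).continuous)⟩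
  simp only [hzero] at hDCT
  rw [← integral_indicator hs.measurableSet]
  exact (tendsto_nhds_unique hDCT tendsto_const_nhds)

/-- The half-open cube `(0, τ]^d`. -/
def leftOpenCell (d : ℕ) (τ : ℝ) : Set (Fin d → ℝ) := Set.univ.pi fun _ => Set.Ioc 0 τ

lemma torusBox_eq_pi (d : ℕ) (L : ℝ) :
    torusBox d L = Set.univ.pi fun _ => Set.Icc 0 (2 * Real.pi * L) := by
  ext x
  simp only [torusBox, Set.mem_ofPred_eq, Set.mem_pi, Set.mem_univ, true_imp_iff, Set.mem_Icc]

lemma leftOpenCell_ae_eq_torusBox (d : ℕ) (L : ℝ) :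
    (leftOpenCell d (2 * Real.pi * L) : Set (Fin d → ℝ)) =ᵐ[volume] torusBox d L := by
  rw [torusBox_eq_pi, Set.pi_univ_Icc]
  exact Measure.univ_pi_Ioc_ae_eq_Icc

lemma halfOpenCell_ae_eq_torusBox (d : ℕ) (L : ℝ) :
    (halfOpenCell d (2 * Real.pi * L) : Set (Fin d → ℝ)) =ᵐ[volume] torusBox d L := by
  rw [torusBox_eq_pi, Set.pi_univ_Icc]
  exact Measure.univ_pi_Ico_ae_eq_Icc

lemma volume_torusBox_lt_top (d : ℕ) (L : ℝ) : volume (torusBox d L) < ∞ := by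
  rw [torusBox_eq_pi, volume_pi_pi]
  exact ENNReal.prod_lt_top fun j _ => by simp

/-- The covering map of the torus `ℝ^d / (τ ℤ)^d`, normalized to period one. -/
noncomputable def torusProj (d : ℕ) (τ : ℝ) (x : Fin d → ℝ) : UnitAddTorus (Fin d) :=
  fun j => ((τ⁻¹ * x j : ℝ) : UnitAddCircle)

/-- A measurable section of `torusProj` with values in `(0, τ]^d`. -/
noncomputable def torusLift (d : ℕ) (τ : ℝ) (t : UnitAddTorus (Fin d)) : Fin d → ℝ :=
  fun j => τ * (AddCircle.equivIoc 1 0 (t j) : ℝ)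

lemma torusLift_torusProj {d : ℕ} {τ : ℝ} (hτ : 0 < τ) {x : Fin d → ℝ}
    (hx : x ∈ leftOpenCell d τ) : torusLift d τ (torusProj d τ x) = x := by
  ext j
  have h1 := hx j (Set.mem_univ j)
  have h2 : τ⁻¹ * x j ∈ Set.Ioc (0 : ℝ) (0 + 1) := by
    refine ⟨mul_pos (inv_pos.2 hτ) h1.1, ?_⟩
    rw [zero_add, inv_mul_le_iff₀ hτ, mul_one]
    exact h1.2
  rw [torusLift, torusProj, AddCircle.equivIoc_coe_of_mem (p := 1) (a := 0) h2]
  rw [mul_inv_cancel_left₀ hτ.ne']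

lemma measurable_torusLift (d : ℕ) (τ : ℝ) : Measurable (torusLift d τ) := by
  refine measurable_pi_lambda _ fun j => ?_
  exact (measurable_subtype_coe.comp
    ((AddCircle.measurableEquivIoc 1 0).measurable.comp (measurable_pi_apply j))).const_mul τ

lemma measurable_torusProj (d : ℕ) (τ : ℝ) : Measurable (torusProj d τ) := by
  refine measurable_pi_lambda _ fun j => ?_
  exact AddCircle.measurable_mk'.comp ((measurable_pi_apply j).const_mul _)

lemma mFourier_torusProj {d : ℕ} {L : ℝ} (hL : 0 < L) (k : Fin d → ℤ) (x : Fin d → ℝ) :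
    UnitAddTorus.mFourier (-k) (torusProj d (2 * Real.pi * L) x) =
      Complex.exp (-Complex.I * (((1 / L) * ∑ j, x j * (k j : ℝ) : ℝ) : ℂ)) := by
  have hpi := Real.pi_ne_zero
  have hpi' : (Real.pi : ℂ) ≠ 0 := by exact_mod_cast hpi
  have hL' : (L : ℂ) ≠ 0 := by exact_mod_cast hL.ne'
  rw [UnitAddTorus.mFourier, ContinuousMap.coe_mk]
  simp only [torusProj, fourier_coe_apply]
  rw [← Complex.exp_sum]
  congr 1
  push_cast
  rw [Finset.mul_sum, Finset.mul_sum]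
  refine Finset.sum_congr rfl fun j _ => ?_
  simp only [Pi.neg_apply, Int.cast_neg]
  field_simp

/-- Uniqueness of Fourier coefficients for integrable functions on the torus. -/
lemma ae_eq_zero_of_torusFourierCoeff_eq_zero {d : ℕ} {L : ℝ} (hL : 0 < L)
    {g : (Fin d → ℝ) → ℂ} (hg : IntegrableOn g (torusBox d L))
    (h : ∀ k, torusFourierCoeff L g k = 0) : g =ᵐ[volume.restrict (torusBox d L)] 0 := by
  have hτ : 0 < 2 * Real.pi * L := by positivity
  rw [← Measure.restrict_congr_set (leftOpenCell_ae_eq_torusBox d L)]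
  set ν := volume.restrict (leftOpenCell d (2 * Real.pi * L)) with hν
  have hgν : Integrable g ν := by
    rw [hν, Measure.restrict_congr_set (leftOpenCell_ae_eq_torusBox d L)]
    exact hg
  set g' := hgν.1.mk g with hg'
  have hgg' : g =ᵐ[ν] g' := hgν.1.ae_eq_mk
  have hcell : ∀ᵐ x ∂ν, x ∈ leftOpenCell d (2 * Real.pi * L) :=
    ae_restrict_mem (MeasurableSet.univ_pi fun _ => measurableSet_Ioc)
  -- A measurable version of g is carried to the compact torus by the section, where characters span
  -- a dense subspace. The cell (0, τ]^d makes the section exact, and it differs from the closed box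
  -- by a null set.
  set G : UnitAddTorus (Fin d) → ℂ := g' ∘ torusLift d (2 * Real.pi * L) with hG
  have hGm : StronglyMeasurable G :=
    hgν.1.stronglyMeasurable_mk.comp_measurable (measurable_torusLift d _)
  have hGπ : (G ∘ torusProj d (2 * Real.pi * L)) =ᵐ[ν] g := by
    filter_upwards [hgg', hcell] with x hx1 hx2
    simp only [hG, Function.comp_apply, torusLift_torusProj hτ hx2, hx1]
  have hπ := measurable_torusProj d (2 * Real.pi * L)
  have hGint : Integrable G (ν.map (torusProj d (2 * Real.pi * L))) := by
    rw [integrable_map_measure hGm.aestronglyMeasurable hπ.aemeasurable]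
    exact hgν.congr hGπ.symm
  have hzero := ae_eq_zero_of_integral_mul_span_eq_zero hGint
    (A := Set.range (UnitAddTorus.mFourier (d := Fin d)))
    UnitAddTorus.span_mFourier_closure_eq_top (by
      rintro _ ⟨k, rfl⟩
      rw [integral_map (f := fun t => UnitAddTorus.mFourier k t * G t) hπ.aemeasurable
        ((UnitAddTorus.mFourier k).continuous.aestronglyMeasurable.mul hGm.aestronglyMeasurable)]
      have hk := h (-k)
      rw [torusFourierCoeff, mul_eq_zero] at hk
      have hk := hk.resolve_left (by
        rw [inv_eq_zero]
        exact_mod_cast (pow_pos hτ d).ne')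
      rw [← hk, ← Measure.restrict_congr_set (leftOpenCell_ae_eq_torusBox d L)]
      refine integral_congr_ae ?_
      filter_upwards [hGπ] with x hx
      rw [← mFourier_torusProj hL, neg_neg, mul_comm]
      congr 1)
  have := ae_of_ae_map hπ.aemeasurable hzero
  filter_upwards [this, hGπ] with x hx1 hx2
  rw [← hx2]
  exact hx1

lemma setIntegral_torusBox_exp {d : ℕ} {L : ℝ} (hL : 0 < L) (n : Fin d → ℤ) :
    ∫ x in torusBox d L, Complex.exp (Complex.I * (((1 / L) * ∑ j, x j * (n j : ℝ) : ℝ) : ℂ)) =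
      if n = 0 then (((2 * Real.pi * L) ^ d : ℝ) : ℂ) else 0 := by
  have hτ : 0 < 2 * Real.pi * L := by positivity
  have hL' : (L : ℂ) ≠ 0 := by exact_mod_cast hL.ne'
  have h1 : ∀ x : Fin d → ℝ, Complex.exp (Complex.I *
      (((1 / L) * ∑ j, x j * (n j : ℝ) : ℝ) : ℂ)) =
      ∏ j, Complex.exp (Complex.I * n j / L * x j) := by
    intro x
    rw [← Complex.exp_sum]
    congr 1
    push_cast
    rw [Finset.mul_sum, Finset.mul_sum]
    refine Finset.sum_congr rfl fun j _ => ?_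
    ring
  simp only [h1]
  rw [← Measure.restrict_congr_set (leftOpenCell_ae_eq_torusBox d L), leftOpenCell, volume_pi,
    Measure.restrict_pi_pi, integral_fintype_prod_eq_prod
      (f := fun j (y : ℝ) => Complex.exp (Complex.I * n j / L * y))]
  have h2 : ∀ j, ∫ y : ℝ in Set.Ioc 0 (2 * Real.pi * L), Complex.exp (Complex.I * n j / L * y) =
      if n j = 0 then ((2 * Real.pi * L : ℝ) : ℂ) else 0 := by
    intro j
    rw [← intervalIntegral.integral_of_le hτ.le]
    split_ifs with hj
    · simp [hj]
    · rw [integral_exp_mul_complex (by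
        have : (n j : ℂ) ≠ 0 := by exact_mod_cast hj
        simp [this, hL'])]
      have h3 : Complex.I * n j / L * ((2 * Real.pi * L : ℝ) : ℂ) =
          n j * (2 * Real.pi * Complex.I) := by
        push_cast
        field_simp
      rw [h3, Complex.exp_int_mul_two_pi_mul_I]
      simp
  simp only [h2]
  split_ifs with hn
  · simp [hn]
  · obtain ⟨j, hj⟩ := Function.ne_iff.1 hn
    refine Finset.prod_eq_zero (Finset.mem_univ j) ?_
    rw [if_neg (by simpa using hj)]

/-- An integrable function on the torus with finitely many nonzero Fourier coefficients is a
trigonometric polynomial. -/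
lemma ae_eq_expSum_of_torusFourierCoeff {d : ℕ} {L : ℝ} (hL : 0 < L)
    {f : (Fin d → ℝ) → ℂ} (hf : IntegrableOn f (torusBox d L)) (s : Finset (Fin d → ℤ))
    (hs : ∀ k, k ∉ s → torusFourierCoeff L f k = 0) :
    f =ᵐ[volume.restrict (torusBox d L)]
      expSum s (torusFourierCoeff L f) (fun k j => (k j : ℝ) / L) := by
  have hτ : 0 < 2 * Real.pi * L := by positivity
  set P := expSum s (torusFourierCoeff L f) (fun (k : Fin d → ℤ) j => (k j : ℝ) / L) with hP
  have hPc : Continuous P := continuous_expSum _ _ _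
  have : IsFiniteMeasure (volume.restrict (torusBox d L)) :=
    ⟨by rw [Measure.restrict_apply_univ]; exact volume_torusBox_lt_top d L⟩
  have hbdd : ∀ h : (Fin d → ℝ) → ℂ, Continuous h → (∃ C, ∀ x, ‖h x‖ ≤ C) →
      IntegrableOn h (torusBox d L) := by
    rintro h hc ⟨C, hC⟩
    exact Integrable.of_bound hc.aestronglyMeasurable C (Filter.Eventually.of_forall hC)
  have hPi : IntegrableOn P (torusBox d L) := hbdd P hPc ⟨_, norm_expSum_le _ _ _⟩
  have hchar : ∀ n : Fin d → ℤ, Continuous fun x : Fin d → ℝ =>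
      Complex.exp (-Complex.I * (((1 / L) * ∑ j, x j * (n j : ℝ) : ℝ) : ℂ)) := by
    intro n; fun_prop
  have hcharn : ∀ (n : Fin d → ℤ) (x : Fin d → ℝ),
      ‖Complex.exp (-Complex.I * (((1 / L) * ∑ j, x j * (n j : ℝ) : ℝ) : ℂ))‖ = 1 := by
    intro n x
    rw [neg_mul, ← mul_neg, mul_comm, ← Complex.ofReal_neg, Complex.norm_exp_ofReal_mul_I]
  have hmulint : ∀ (h : (Fin d → ℝ) → ℂ) (n : Fin d → ℤ), IntegrableOn h (torusBox d L) →
      IntegrableOn (fun x => h x *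
        Complex.exp (-Complex.I * (((1 / L) * ∑ j, x j * (n j : ℝ) : ℝ) : ℂ))) (torusBox d L) :=
    fun h n hh => hh.mul_bdd (hchar n).aestronglyMeasurable (c := 1)
      (Filter.Eventually.of_forall fun x => (hcharn n x).le)
  have hPcoeff : ∀ n, torusFourierCoeff L P n = torusFourierCoeff L f n := by
    intro n
    rw [torusFourierCoeff, hP]
    have h1 : ∀ x : Fin d → ℝ, P x *
        Complex.exp (-Complex.I * (((1 / L) * ∑ j, x j * (n j : ℝ) : ℝ) : ℂ)) =
        ∑ k ∈ s, torusFourierCoeff L f k *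
          Complex.exp (Complex.I * (((1 / L) * ∑ j, x j * (((k - n) j : ℤ) : ℝ) : ℝ) : ℂ)) := by
      intro x
      rw [hP, expSum, Finset.sum_mul]
      refine Finset.sum_congr rfl fun k _ => ?_
      rw [mul_assoc, ← Complex.exp_add]
      congr 2
      simp only [dotProduct, Pi.sub_apply]
      push_cast
      simp only [Finset.mul_sum, Finset.sum_mul, ← Finset.sum_add_distrib]
      refine Finset.sum_congr rfl fun j _ => ?_
      ring
    simp only [← hP, h1]
    rw [integral_finsetSum]
    · simp only [integral_const_mul, setIntegral_torusBox_exp hL, sub_eq_zero]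
      by_cases hn : n ∈ s
      · rw [Finset.sum_eq_single n (fun k _ hk => by rw [if_neg hk, mul_zero])
          (fun h => absurd hn h), if_pos rfl, mul_comm, mul_assoc, mul_inv_cancel₀, mul_one]
        exact_mod_cast (pow_pos hτ d).ne'
      · rw [Finset.sum_eq_zero, mul_zero, hs n hn]
        intro k hk
        rw [if_neg (by rintro rfl; exact hn hk), mul_zero]
    · intro k _
      refine (hbdd _ (by fun_prop) ⟨1, fun x => ?_⟩).const_mul _
      rw [mul_comm, Complex.norm_exp_ofReal_mul_I]
  have hz := ae_eq_zero_of_torusFourierCoeff_eq_zero hL (g := fun x => f x - P x)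
    (hf.sub hPi) (fun n => by
      have := hPcoeff n
      rw [torusFourierCoeff] at this ⊢
      simp only [sub_mul]
      rw [integral_sub (hmulint f n hf) (hmulint P n hPi), mul_sub, this, torusFourierCoeff,
        sub_self])
  filter_upwards [hz] with x hx
  exact sub_eq_zero.1 hx

/-! ### Reduction to exponential sums and the final constant -/

lemma IsThickSet.exists_measurable_subset {d : ℕ} {γ : ℝ} {a : Fin d → ℝ} {S : Set (Fin d → ℝ)}
    (hS : IsThickSet γ a S) :
    ∃ S' : Set (Fin d → ℝ), MeasurableSet S' ∧ S' =ᵐ[volume] S ∧ IsThickSet γ a S' := by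
  obtain ⟨S', _, hm, hae⟩ := hS.measurable.exists_measurable_subset_ae_eq
  refine ⟨S', hm, hae, hm.nullMeasurableSet, hS.gamma_pos, hS.gamma_le_one, hS.side_pos, fun x => ?_⟩
  rw [measure_congr (ae_eq_set_inter hae (Filter.EventuallyEq.refl _ (centredBox x a)))]
  exact hS.density x

lemma finite_torusFourierCoeff_ne_zero {d : ℕ} {L : ℝ} (hL : 0 < L) {f : (Fin d → ℝ) → ℂ}
    {center b : Fin d → ℝ} (h : torusFourierSupport L f ⊆ centredBox center b) :
    {k : Fin d → ℤ | torusFourierCoeff L f k ≠ 0}.Finite := by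
  refine (Set.finite_Icc (fun j => ⌈(center j - b j / 2) * L⌉)
    (fun j => ⌊(center j + b j / 2) * L⌋)).subset fun k hk => ?_
  have hmem := h (show (fun j => (k j : ℝ) / L) ∈ torusFourierSupport L f from ⟨k, fun _ => rfl, hk⟩)
  refine ⟨fun j => ?_, fun j => ?_⟩
  · rw [Int.ceil_le, ← le_div_iff₀ hL]
    exact (hmem j).1
  · rw [Int.le_floor, ← div_le_iff₀ hL]
    exact (hmem j).2

/-- This makes the location of the spectral box irrelevant. The shifted sum need not be periodic,
but its modulus is, and only the modulus is integrated. -/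
lemma norm_expSum_sub_freq {ι : Type*} {d : ℕ} (s : Finset ι) (c : ι → ℂ) (ξ : ι → Fin d → ℝ)
    (v x : Fin d → ℝ) : ‖expSum s c (fun k => ξ k - v) x‖ = ‖expSum s c ξ x‖ := by
  have h1 : expSum s c ξ x = expSum s c (fun k => ξ k - v) x *
      Complex.exp (((v ⬝ᵥ x : ℝ) : ℂ) * Complex.I) := by
    rw [expSum, expSum, Finset.sum_mul]
    refine Finset.sum_congr rfl fun k _ => ?_
    rw [mul_assoc, ← Complex.exp_add, sub_dotProduct]
    push_cast
    ring_nf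
  rw [h1, norm_mul, Complex.norm_exp_ofReal_mul_I, mul_one]

lemma expSum_int_div_coordPeriodic {d : ℕ} {L : ℝ} (hL : 0 < L) (s : Finset (Fin d → ℤ))
    (c : (Fin d → ℤ) → ℂ) :
    CoordPeriodic (2 * Real.pi * L) (expSum s c (fun k j => (k j : ℝ) / L)) := by
  intro j x
  rw [expSum_add_single]
  refine Finset.sum_congr rfl fun k _ => ?_
  have h1 : (((k j : ℝ) / L * (2 * Real.pi * L) : ℝ) : ℂ) * Complex.I =
      k j * (2 * Real.pi * Complex.I) := by
    have hL' : (L : ℂ) ≠ 0 := by exact_mod_cast hL.ne'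
    push_cast
    field_simp
  rw [h1, Complex.exp_int_mul_two_pi_mul_I, mul_one]

/-- The base inverts to 2880·d·4^d/γ², with 2880 = 4·4·180, and d ≤ 2^d bounds it by the square of
2880^d/γ. The square doubles 1440 to 2880, so one constant serves as both base and exponent. -/
lemma thick_constant_bound {d : ℕ} (hd : 1 ≤ d) {γ A p : ℝ} (hγ : 0 < γ) (hγ1 : γ ≤ 1)
    (hA : 0 ≤ A) (hp : 0 < p) :
    ((((γ / 2 ^ d / 2) ^ 2 / (4 * d) / 180) ^ (1440 * A)) ^ p * (γ / 2 ^ d / 2))⁻¹ * 2 ≤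
      (((2880 : ℝ) ^ d / γ) ^ (2880 * A + (6 * (d : ℝ) + 1) * p⁻¹)) ^ p := by
  have hd0 : (0 : ℝ) < d := by exact_mod_cast hd
  set X : ℝ := (2880 : ℝ) ^ d / γ with hX
  have hX1 : 1 ≤ X := by
    rw [hX, le_div_iff₀ hγ, one_mul]
    exact hγ1.trans (one_le_pow₀ (by norm_num))
  have hX0 : 0 < X := by linarith
  have hd2 : (d : ℝ) ≤ 2 ^ d := by exact_mod_cast Nat.lt_two_pow_self.le
  have h1 : ((γ / 2 ^ d / 2) ^ 2 / (4 * d) / 180)⁻¹ ≤ X ^ 2 := by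
    have e1 : ((γ / 2 ^ d / 2) ^ 2 / (4 * d) / 180)⁻¹ = 2880 * d * (2 ^ d) ^ 2 / γ ^ 2 := by
      field_simp
      ring
    rw [e1, hX, div_pow]
    gcongr
    have h2 : (2880 : ℝ) ≤ 2880 ^ d := le_self_pow₀ (by norm_num) (by omega)
    calc (2880 : ℝ) * d * (2 ^ d) ^ 2 ≤ 2880 ^ d * 2 ^ d * (2 ^ d) ^ 2 := by gcongr
      _ = 2880 ^ d * 8 ^ d := by
        rw [mul_assoc]
        congr 1
        rw [← pow_succ', ← pow_mul, mul_comm, pow_mul]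
        norm_num
      _ ≤ 2880 ^ d * 2880 ^ d := by gcongr; norm_num
      _ = (2880 ^ d) ^ 2 := by ring
  have h2 : (γ / 2 ^ d / 2)⁻¹ * 2 ≤ X := by
    have e1 : (γ / 2 ^ d / 2)⁻¹ * 2 = 4 * 2 ^ d / γ := by
      field_simp
      ring
    rw [e1, hX]
    gcongr
    have h3 : (4 : ℝ) ≤ 4 ^ d := le_self_pow₀ (by norm_num) (by omega)
    calc (4 : ℝ) * 2 ^ d ≤ 4 ^ d * 2 ^ d := by gcongr
      _ = 8 ^ d := by rw [← mul_pow]; norm_num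
      _ ≤ 2880 ^ d := by gcongr; norm_num
  have hbase : 0 < (γ / 2 ^ d / 2) ^ 2 / (4 * d) / 180 := by positivity
  calc ((((γ / 2 ^ d / 2) ^ 2 / (4 * d) / 180) ^ (1440 * A)) ^ p * (γ / 2 ^ d / 2))⁻¹ * 2
      = ((((γ / 2 ^ d / 2) ^ 2 / (4 * d) / 180)⁻¹) ^ (1440 * A)) ^ p *
          ((γ / 2 ^ d / 2)⁻¹ * 2) := by
        rw [mul_inv, Real.inv_rpow hbase.le, Real.inv_rpow (by positivity), mul_assoc]
    _ ≤ ((X ^ 2) ^ (1440 * A)) ^ p * X := by gcongr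
    _ = X ^ (2880 * A * p + 1) := by
        rw [← Real.rpow_natCast, ← Real.rpow_mul hX0.le, ← Real.rpow_mul hX0.le,
          Real.rpow_add hX0, Real.rpow_one]
        congr 2
        push_cast
        ring
    -- A single factor X, that is 1/p in the exponent, is what the argument costs; the remaining
    -- 6d/p is slack.
    _ ≤ X ^ ((2880 * A + (6 * (d : ℝ) + 1) * p⁻¹) * p) := by
        refine Real.rpow_le_rpow_of_exponent_le hX1 ?_
        rw [add_mul, mul_assoc (6 * (d : ℝ) + 1), inv_mul_cancel₀ hp.ne']
        linarith
    _ = _ := Real.rpow_mul hX0.le _ _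

/-- The torus Logvinenko-Sereda inequality for `p < ∞` and nondegenerate spectral boxes. -/
lemma eLpNorm_le_of_thick_of_pos {d : ℕ} (hd : 1 ≤ d) {L : ℝ} (hL : 0 < L) {p : ℝ≥0∞} (hp : 1 ≤ p)
    (hpt : p ≠ ∞) {f : (Fin d → ℝ) → ℂ} (hf : MemLp f p (volume.restrict (torusBox d L)))
    {center b : Fin d → ℝ} (hb : ∀ j, 0 < b j)
    (hsupp : torusFourierSupport L f ⊆ centredBox center b)
    {γ : ℝ} {a : Fin d → ℝ} {S : Set (Fin d → ℝ)} (hS : IsThickSet γ a S)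
    (ha : ∀ j, a j ≤ 2 * Real.pi * L) :
    eLpNorm f p (volume.restrict (torusBox d L)) ≤
      ENNReal.ofReal (((2880 : ℝ) ^ d / γ) ^
        (2880 * (∑ j, a j * b j) + (6 * (d : ℝ) + 1) * (p⁻¹).toReal)) *
        eLpNorm f p (volume.restrict (S ∩ torusBox d L)) := by
  have : IsFiniteMeasure (volume.restrict (torusBox d L)) :=
    ⟨by rw [Measure.restrict_apply_univ]; exact volume_torusBox_lt_top d L⟩
  have hp0 : p ≠ 0 := (zero_lt_one.trans_le hp).ne'
  set q := p.toReal with hq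
  have hq0 : 0 < q := ENNReal.toReal_pos hp0 hpt
  have hq1 : 1 ≤ q := by
    rw [hq, ← ENNReal.toReal_one]
    exact ENNReal.toReal_mono hpt hp
  have hτ : 0 < 2 * Real.pi * L := by positivity
  obtain ⟨S', hS'm, hS'S, hS'⟩ := hS.exists_measurable_subset
  set s := (finite_torusFourierCoeff_ne_zero hL hsupp).toFinset with hs
  have hfP := ae_eq_expSum_of_torusFourierCoeff hL (hf.integrable hp) s (fun k hk => by
    by_contra h0
    exact hk (by simpa [hs] using h0))
  set P := expSum s (torusFourierCoeff L f) (fun (k : Fin d → ℤ) j => (k j : ℝ) / L) with hP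
  set ξ : (Fin d → ℤ) → Fin d → ℝ := fun k => (fun j => (k j : ℝ) / L) - center with hξ
  set F := expSum s (torusFourierCoeff L f) ξ with hF
  have hFP : ∀ x, ‖F x‖ₑ = ‖P x‖ₑ := fun x => by
    rw [← ofReal_norm, ← ofReal_norm]
    congr 1
    exact norm_expSum_sub_freq s _ (fun (k : Fin d → ℤ) j => (k j : ℝ) / L) center x
  have hξb : ∀ k ∈ s, ∀ j, |ξ k j| ≤ b j / 2 := by
    intro k hk j
    have hk' : torusFourierCoeff L f k ≠ 0 := by simpa [hs] using hk
    have hmem := hsupp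
      (show (fun j => (k j : ℝ) / L) ∈ torusFourierSupport L f from ⟨k, fun _ => rfl, hk'⟩) j
    simp only [hξ, Pi.sub_apply]
    rw [abs_le]
    constructor <;> linarith [hmem.1, hmem.2]
  have hper : CoordPeriodic (2 * Real.pi * L) fun x => ‖F x‖ₑ := fun j x => by
    simp only [hFP]
    rw [hP, expSum_int_div_coordPeriodic hL s _ j x]
  have key := expSum_setLIntegral_le hd s (torusFourierCoeff L f) ξ hb hξb hτ ha hper hq1 hS' hS'm
  set A := ∑ j, a j * b j with hA
  have hA0 : 0 ≤ A := Finset.sum_nonneg fun j _ => (mul_pos (hS.side_pos j) (hb j)).le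
  have hγ := hS.gamma_pos
  have hd0 : (0 : ℝ) < d := by exact_mod_cast hd
  have hIT : ∫⁻ x in halfOpenCell d (2 * Real.pi * L), ‖F x‖ₑ ^ q =
      ∫⁻ x in torusBox d L, ‖f x‖ₑ ^ q := by
    rw [Measure.restrict_congr_set (halfOpenCell_ae_eq_torusBox d L)]
    refine lintegral_congr_ae ?_
    filter_upwards [hfP] with x hx
    rw [hFP, hx]
  have hIS : ∫⁻ x in S' ∩ halfOpenCell d (2 * Real.pi * L), ‖F x‖ₑ ^ q =
      ∫⁻ x in S ∩ torusBox d L, ‖f x‖ₑ ^ q := by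
    rw [Measure.restrict_congr_set (ae_eq_set_inter hS'S (halfOpenCell_ae_eq_torusBox d L))]
    refine lintegral_congr_ae ?_
    filter_upwards [ae_mono (Measure.restrict_mono Set.inter_subset_right le_rfl) hfP] with x hx
    rw [hFP, hx]
  rw [← hF, hIT, hIS] at key
  set lam := ((γ / 2 ^ d / 2) ^ 2 / (4 * d) / 180) ^ (1440 * A) with hlam
  have hlam0 : 0 < lam := by positivity
  rw [ENNReal.ofReal_rpow_of_pos hlam0, ← ENNReal.ofReal_mul (by positivity)] at key
  have hC0 : 0 < lam ^ q * (γ / 2 ^ d / 2) := by positivity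
  have hbound : ∫⁻ x in torusBox d L, ‖f x‖ₑ ^ q ≤
      ENNReal.ofReal (((2880 : ℝ) ^ d / γ) ^ (2880 * A + (6 * (d : ℝ) + 1) * q⁻¹)) ^ q *
        ∫⁻ x in S ∩ torusBox d L, ‖f x‖ₑ ^ q := by
    have hcC : ENNReal.ofReal (lam ^ q * (γ / 2 ^ d / 2))⁻¹ *
        ENNReal.ofReal (lam ^ q * (γ / 2 ^ d / 2)) = 1 := by
      rw [← ENNReal.ofReal_mul (by positivity), inv_mul_cancel₀ hC0.ne', ENNReal.ofReal_one]
    calc ∫⁻ x in torusBox d L, ‖f x‖ₑ ^ q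
        = ENNReal.ofReal (lam ^ q * (γ / 2 ^ d / 2))⁻¹ *
          (ENNReal.ofReal (lam ^ q * (γ / 2 ^ d / 2)) * ∫⁻ x in torusBox d L, ‖f x‖ₑ ^ q) := by
          rw [← mul_assoc, hcC, one_mul]
      _ ≤ ENNReal.ofReal (lam ^ q * (γ / 2 ^ d / 2))⁻¹ *
          (2 * ∫⁻ x in S ∩ torusBox d L, ‖f x‖ₑ ^ q) := mul_le_mul' le_rfl key
      _ = ENNReal.ofReal ((lam ^ q * (γ / 2 ^ d / 2))⁻¹ * 2) *
          ∫⁻ x in S ∩ torusBox d L, ‖f x‖ₑ ^ q := by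
          rw [← mul_assoc, ENNReal.ofReal_mul (by positivity), ENNReal.ofReal_ofNat]
      _ ≤ _ := by
          rw [ENNReal.ofReal_rpow_of_nonneg (by positivity) hq0.le]
          exact mul_le_mul' (ENNReal.ofReal_le_ofReal
            (thick_constant_bound hd hγ hS.gamma_le_one hA0 hq0)) le_rfl
  rw [eLpNorm_eq_lintegral_rpow_enorm_toReal hp0 hpt, eLpNorm_eq_lintegral_rpow_enorm_toReal hp0 hpt,
    ← hq, ENNReal.toReal_inv, ← hq]
  refine (ENNReal.rpow_le_rpow hbound (by positivity)).trans (le_of_eq ?_)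
  rw [ENNReal.mul_rpow_of_nonneg _ _ (by positivity), ← ENNReal.rpow_mul,
    mul_one_div_cancel hq0.ne', ENNReal.rpow_one]

/-- The torus Logvinenko-Sereda inequality for `p < ∞`. -/
lemma eLpNorm_le_of_thick_of_ne_top {d : ℕ} (hd : 1 ≤ d) {L : ℝ} (hL : 0 < L) {p : ℝ≥0∞}
    (hp : 1 ≤ p) (hpt : p ≠ ∞) {f : (Fin d → ℝ) → ℂ}
    (hf : MemLp f p (volume.restrict (torusBox d L)))
    {center b : Fin d → ℝ} (hb : ∀ j, 0 ≤ b j)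
    (hsupp : torusFourierSupport L f ⊆ centredBox center b)
    {γ : ℝ} {a : Fin d → ℝ} {S : Set (Fin d → ℝ)} (hS : IsThickSet γ a S)
    (ha : ∀ j, a j ≤ 2 * Real.pi * L) :
    eLpNorm f p (volume.restrict (torusBox d L)) ≤
      ENNReal.ofReal (((2880 : ℝ) ^ d / γ) ^
        (2880 * (∑ j, a j * b j) + (6 * (d : ℝ) + 1) * (p⁻¹).toReal)) *
        eLpNorm f p (volume.restrict (S ∩ torusBox d L)) := by
  have hX : 0 < (2880 : ℝ) ^ d / γ := div_pos (by positivity) hS.gamma_pos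
  have hcont : Continuous fun ε : ℝ => ((2880 : ℝ) ^ d / γ) ^
      (2880 * (∑ j, a j * (b j + ε)) + (6 * (d : ℝ) + 1) * (p⁻¹).toReal) :=
    Continuous.rpow continuous_const (by fun_prop) fun _ => Or.inl hX.ne'
  have hlim : Filter.Tendsto (fun ε : ℝ => ENNReal.ofReal (((2880 : ℝ) ^ d / γ) ^
      (2880 * (∑ j, a j * (b j + ε)) + (6 * (d : ℝ) + 1) * (p⁻¹).toReal)) *
        eLpNorm f p (volume.restrict (S ∩ torusBox d L))) (nhdsWithin 0 (Set.Ioi 0))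
      (nhds (ENNReal.ofReal (((2880 : ℝ) ^ d / γ) ^
        (2880 * (∑ j, a j * b j) + (6 * (d : ℝ) + 1) * (p⁻¹).toReal)) *
        eLpNorm f p (volume.restrict (S ∩ torusBox d L)))) := by
    refine ENNReal.Tendsto.mul_const ?_ (Or.inl ?_)
    · have := (ENNReal.continuous_ofReal.comp hcont).tendsto 0
      simp only [Function.comp_def, add_zero] at this
      exact this.mono_left nhdsWithin_le_nhds
    · exact (ENNReal.ofReal_pos.2 (by positivity)).ne'
  refine ge_of_tendsto hlim ?_
  -- Each side is enlarged by ε about the same centre, and ε tends to 0 from above.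
  filter_upwards [self_mem_nhdsWithin] with ε hε
  refine eLpNorm_le_of_thick_of_pos (center := center) hd hL hp hpt hf (fun j => add_pos_of_nonneg_of_pos (hb j) hε)
    (hsupp.trans fun x hx j => ?_) hS ha
  have := hx j
  have hε' : (0 : ℝ) < ε := hε
  constructor <;> linarith [this.1, this.2]

/-! ### The limit p → ∞ -/

lemma tendsto_const_rpow_one_div {m : ℝ≥0∞} (h0 : m ≠ 0) (ht : m ≠ ∞) :
    Filter.Tendsto (fun n : ℕ => m ^ (1 / ((n : ℝ) + 1))) Filter.atTop (nhds 1) := by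
  have hm : 0 < m.toReal := ENNReal.toReal_pos h0 ht
  have h1 : Filter.Tendsto (fun n : ℕ => ENNReal.ofReal (m.toReal ^ (1 / ((n : ℝ) + 1))))
      Filter.atTop (nhds (ENNReal.ofReal (m.toReal ^ (0 : ℝ)))) :=
    ENNReal.tendsto_ofReal (Filter.Tendsto.rpow tendsto_const_nhds
      tendsto_one_div_add_atTop_nhds_zero_nat (Or.inl hm.ne'))
  rw [Real.rpow_zero, ENNReal.ofReal_one] at h1
  refine h1.congr fun n => ?_
  rw [← ENNReal.ofReal_rpow_of_pos hm, ENNReal.ofReal_toReal ht]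

/-- Passing to the limit `p → ∞` in a family of norm inequalities between two measures. -/
lemma eLpNorm_top_le_of_forall_nat {E : Type*} [MeasurableSpace E] {μ ν : Measure E}
    [IsFiniteMeasure μ] [IsFiniteMeasure ν] {f : E → ℂ} (hf : MemLp f ∞ μ)
    (hν : AEStronglyMeasurable f ν)
    {C : ℕ → ℝ≥0∞} {C₀ : ℝ≥0∞} (hC : Filter.Tendsto C Filter.atTop (nhds C₀)) (hC0 : C₀ ≠ ∞)
    (hνfin : eLpNorm f ∞ ν ≠ ∞)
    (h : ∀ n : ℕ, eLpNorm f ((n + 1 : ℕ) : ℝ≥0∞) μ ≤ C n * eLpNorm f ((n + 1 : ℕ) : ℝ≥0∞) ν) :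
    eLpNorm f ∞ μ ≤ C₀ * eLpNorm f ∞ ν := by
  refine le_of_forall_lt fun t ht => ?_
  obtain ⟨r, htr, hr⟩ := exists_between ht
  refine htr.trans_le ?_
  -- For r below the essential supremum this level set has positive measure, and by Chebyshev r *
  -- m^(1/p) is a lower bound for the L^p norm that tends to r.
  set m := μ {x | r ≤ ‖f x‖ₑ} with hm
  have hm0 : m ≠ 0 := by
    intro h0
    have : eLpNorm f ∞ μ ≤ r := by
      rw [eLpNorm_exponent_top]
      refine eLpNormEssSup_le_of_ae_enorm_bound ?_
      have : ∀ᵐ x ∂μ, ¬ r ≤ ‖f x‖ₑ := by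
        rw [ae_iff]
        simpa [hm] using h0
      filter_upwards [this] with x hx
      exact (not_le.1 hx).le
    exact absurd hr (not_lt.2 this)
  have hmt : m ≠ ∞ := measure_ne_top _ _
  -- Adding 1 keeps V nonzero even when ν = 0, so its roots tend to 1.
  set V := ν Set.univ + 1 with hV
  have hV0 : V ≠ 0 := by simp [hV]
  have hVt : V ≠ ∞ := by simp [hV]
  have hrt : r ≠ ∞ := (hr.trans hf.eLpNorm_lt_top).ne
  have hineq : ∀ n : ℕ, r * m ^ (1 / ((n : ℝ) + 1)) ≤
      C n * (eLpNorm f ∞ ν * V ^ (1 / ((n : ℝ) + 1))) := by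
    intro n
    have hn0 : ((n + 1 : ℕ) : ℝ≥0∞) ≠ 0 := by simp
    have hnt : ((n + 1 : ℕ) : ℝ≥0∞) ≠ ∞ := ENNReal.natCast_ne_top _
    have hnr : (((n + 1 : ℕ) : ℝ≥0∞)).toReal = (n : ℝ) + 1 := by
      rw [ENNReal.toReal_natCast]; push_cast; rfl
    have hpos : (0 : ℝ) < (n : ℝ) + 1 := by positivity
    have h1 := mul_meas_ge_le_pow_eLpNorm' μ hn0 hnt hf.1 r
    rw [hnr] at h1
    have h2 : r * m ^ (1 / ((n : ℝ) + 1)) ≤ eLpNorm f ((n + 1 : ℕ) : ℝ≥0∞) μ := by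
      have := ENNReal.rpow_le_rpow h1 (z := 1 / ((n : ℝ) + 1)) (by positivity)
      rwa [ENNReal.mul_rpow_of_nonneg _ _ (by positivity), ← ENNReal.rpow_mul, ← ENNReal.rpow_mul,
        mul_one_div_cancel hpos.ne', ENNReal.rpow_one, ENNReal.rpow_one] at this
    refine h2.trans ((h n).trans (mul_le_mul' le_rfl ?_))
    have h3 := eLpNorm_le_eLpNorm_mul_rpow_measure_univ (p := ((n + 1 : ℕ) : ℝ≥0∞)) (q := ∞)
      le_top hν
    rw [hnr, ENNReal.toReal_top, div_zero, sub_zero] at h3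
    refine h3.trans (mul_le_mul' le_rfl (ENNReal.rpow_le_rpow ?_ (by positivity)))
    exact le_self_add
  have hl1 : Filter.Tendsto (fun n : ℕ => r * m ^ (1 / ((n : ℝ) + 1))) Filter.atTop (nhds (r * 1)) :=
    ENNReal.Tendsto.const_mul (tendsto_const_rpow_one_div hm0 hmt) (Or.inl one_ne_zero)
  have hl2 : Filter.Tendsto (fun n : ℕ => C n * (eLpNorm f ∞ ν * V ^ (1 / ((n : ℝ) + 1))))
      Filter.atTop (nhds (C₀ * (eLpNorm f ∞ ν * 1))) := by
    refine ENNReal.Tendsto.mul hC (Or.inr ?_) ?_ (Or.inr hC0)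
    · rw [mul_one]; exact hνfin
    · exact ENNReal.Tendsto.const_mul (tendsto_const_rpow_one_div hV0 hVt) (Or.inl one_ne_zero)
  have := le_of_tendsto_of_tendsto' hl1 hl2 hineq
  rwa [mul_one, mul_one] at this

theorem theorem1 :
    ∃ c : ℝ, 0 < c ∧
      ∀ (d : ℕ), 1 ≤ d →
      ∀ (L : ℝ), 0 < L →
      ∀ (p : ℝ≥0∞), 1 ≤ p →
      ∀ (f : (Fin d → ℝ) → ℂ), MemLp f p (volume.restrict (torusBox d L)) →
      ∀ (center b : Fin d → ℝ), (∀ j, 0 ≤ b j) →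
        torusFourierSupport L f ⊆ centredBox center b →
      ∀ (γ : ℝ) (a : Fin d → ℝ) (S : Set (Fin d → ℝ)), IsThickSet γ a S →
        (∀ j, a j ≤ 2 * Real.pi * L) →
        eLpNorm f p (volume.restrict (torusBox d L)) ≤
          ENNReal.ofReal
              ((c ^ d / γ) ^ (c * (∑ j, a j * b j) + (6 * (d : ℝ) + 1) * (p⁻¹).toReal)) *
            eLpNorm f p (volume.restrict (S ∩ torusBox d L)) := by
  refine ⟨2880, by norm_num, ?_⟩
  intro d hd L hL p hp f hf center b hb hsupp γ a S hS ha
  by_cases hpt : p = ∞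
  · subst hpt
    have hfin : IsFiniteMeasure (volume.restrict (torusBox d L)) :=
      ⟨by rw [Measure.restrict_apply_univ]; exact volume_torusBox_lt_top d L⟩
    have hle : volume.restrict (S ∩ torusBox d L) ≤ volume.restrict (torusBox d L) :=
      Measure.restrict_mono Set.inter_subset_right le_rfl
    have hfin' : IsFiniteMeasure (volume.restrict (S ∩ torusBox d L)) :=
      isFiniteMeasure_of_le _ hle
    have hX : 0 < (2880 : ℝ) ^ d / γ := div_pos (by positivity) hS.gamma_pos
    refine eLpNorm_top_le_of_forall_nat hf (hf.1.mono_measure hle)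
      (C := fun n => ENNReal.ofReal (((2880 : ℝ) ^ d / γ) ^
        (2880 * (∑ j, a j * b j) + (6 * (d : ℝ) + 1) * (1 / ((n : ℝ) + 1))))) ?_
      ENNReal.ofReal_ne_top (hf.mono_measure hle).eLpNorm_ne_top fun n => ?_
    · refine ENNReal.tendsto_ofReal (Filter.Tendsto.rpow tendsto_const_nhds ?_ (Or.inl hX.ne'))
      rw [ENNReal.inv_top, ENNReal.toReal_zero]
      exact (tendsto_one_div_add_atTop_nhds_zero_nat.const_mul _).const_add _
    · have := eLpNorm_le_of_thick_of_ne_top hd hL (p := ((n + 1 : ℕ) : ℝ≥0∞))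
        (by exact_mod_cast Nat.le_add_left 1 n) (ENNReal.natCast_ne_top _)
        (hf.mono_exponent le_top) hb hsupp hS ha
      rw [ENNReal.toReal_inv, ENNReal.toReal_natCast] at this
      rw [one_div]
      push_cast at this ⊢
      exact this
  · exact eLpNorm_le_of_thick_of_ne_top hd hL hp hpt hf hb hsupp hS ha
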